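/- Let $W,V:\mathbb R\to\mathbb R$ be strictly increasing, with $W$ right-continuous and $V$ left-continuous, and suppose that $W(x+1)-W(x)=W(1)-W(0)$ and $V(x+1)-V(x)=V(1)-V(0)$ for all $x\in\mathbb R$. Let $dW$ and $dV$ be the Borel measures with $dW((a,b])=W(b)-W(a)$ and $dV([a,b))=V(b)-V(a)$ (they may have atoms), and let $L^2_V(\mathbb T)$ be the real $L^2$ space of the torus $\mathbb T=\mathbb R/\mathbb Z\cong[0,1)$ with the measure $dV$. The $W$-$V$-Laplacian $\Delta_{W,V}:\mathcal D_{W,V}(\mathbb T)\subseteq L^2_V(\mathbb T)\to L^2_V(\mathbb T)$ is defined as follows: $f\in\mathcal D_{W,V}(\mathbb T)$ and $\Delta_{W,V}f=\mathfrak f$ if and only if $\mathfrak f\in L^2_V(\mathbb T)$, $\int_{\mathbb T}\mathfrak f\,dV=0$, and there are $a,b\in\mathbb R$ such that $$f(x)=a+b\,(W(x)-W(0))+\int_{(0,x]}\int_{[0,y)}\mathfrak f(s)\,dV(s)\,dW(y)\quad\text{for } dV\text{-a.e. }x\in[0,1),$$ $$b\,(W(1)-W(0))+\int_{(0,1]}\int_{[0,y)}\mathfrak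 f(s)\,dV(s)\,dW(y)=0 .$$ Then the eigenvalues of $-\Delta_{W,V}$, counted with multiplicity, can be listed as a nondecreasing sequence $0=\lambda_0\le\lambda_1\le\lambda_2\le\cdots$, and there are $\rho\in(0,\tfrac12]$ and $C>0$ such that $$\lambda_n\ \ge\ C\,n^{1/\rho}\qquad\text{for all } n\ge 1,$$ and $$\sum_{i=1}^{\infty}\frac1{\lambda_i^{\,s}}<\infty\qquad\text{for every } s>\rho .$$ Moreover the upper bound $\tfrac12$ for $\rho$ is attained when $W(x)=V(x)=x$: in that case there are $c,C>0$ with $c\,n^2\le\lambda_n\le C\,n^2$ for all $n\ge1$, so that if $\rho>0$ and $C'>0$ satisfy $\lambda_n\ge C' n^{1/\rho}$ for all $n\ge1$, then $\rho\ge\tfrac12$. -/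

import Mathlib

open MeasureTheory Set Filter Topology

noncomputable section

namespace WVLaplacian

/-- The Borel measure `dF` on `ℝ` induced by a nondecreasing function `F`, atoms allowed. It is the
Stieltjes measure of the right-continuous modification of `F`. It does not depend on the values of
`F` at its jumps: `dF (a, b] = F b - F a` when `F` is right-continuous (`dMeas_Ioc`), and
`dF [a, b) = F b - F a` when `F` is left-continuous (`dMeas_Ico`). -/
def dMeas {F : ℝ → ℝ} (hF : Monotone F) : Measure ℝ := hF.stieltjesFunction.measure

theorem dMeas_Ioc {F : ℝ → ℝ} (hF : Monotone F) (hr : ∀ x, ContinuousWithinAt F (Ioi x) x)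
    (a b : ℝ) : dMeas hF (Ioc a b) = ENNReal.ofReal (F b - F a) := by
  have key : ∀ x, hF.stieltjesFunction x = F x := fun x =>
    hF.continuousWithinAt_Ioi_iff_rightLim_eq.1 (hr x)
  rw [dMeas, StieltjesFunction.measure_Ioc, key, key]

theorem dMeas_Ico {F : ℝ → ℝ} (hF : Monotone F) (hl : ∀ x, ContinuousWithinAt F (Iio x) x)
    (a b : ℝ) : dMeas hF (Ico a b) = ENNReal.ofReal (F b - F a) := by
  have key : ∀ x, Function.leftLim hF.stieltjesFunction x = F x := by
    intro x
    apply leftLim_eq_of_tendsto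
    have h1 : Tendsto F (𝓝[<] x) (𝓝 (F x)) := hl x
    refine tendsto_of_tendsto_of_tendsto_of_le_of_le' h1 tendsto_const_nhds ?_ ?_
    · filter_upwards with y
      rw [Monotone.stieltjesFunction_eq]
      exact hF.le_rightLim le_rfl
    · filter_upwards [self_mem_nhdsWithin] with y hy
      rw [Monotone.stieltjesFunction_eq]
      exact hF.rightLim_le hy
  rw [dMeas, StieltjesFunction.measure_Ico, key, key]

instance {F : ℝ → ℝ} (hF : Monotone F) : IsLocallyFiniteMeasure (dMeas hF) := by
  unfold dMeas; infer_instance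

/-- The measure `dV` on the torus `𝕋 = ℝ/ℤ`, realized on its fundamental domain `[0, 1)`. -/
def torusMeas {V : ℝ → ℝ} (hV : Monotone V) : Measure ℝ := (dMeas hV).restrict (Ico 0 1)

instance {V : ℝ → ℝ} (hV : Monotone V) : IsFiniteMeasure (torusMeas hV) :=
  ⟨by
    rw [torusMeas, Measure.restrict_apply_univ]
    exact (measure_mono Ico_subset_Icc_self).trans_lt isCompact_Icc.measure_lt_top⟩

/-- The real Hilbert space `L²_V(𝕋)`. -/
abbrev L2 {V : ℝ → ℝ} (hV : Monotone V) : Type := Lp ℝ 2 (torusMeas hV)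

/-- The inner primitive `y ↦ ∫_{[0,y)} h dV`. -/
def primV {V : ℝ → ℝ} (hV : Monotone V) (h : ℝ → ℝ) (y : ℝ) : ℝ :=
  ∫ s in Ico 0 y, h s ∂(dMeas hV)

/-- The iterated primitive `x ↦ ∫_{(0,x]} ∫_{[0,y)} h(s) dV(s) dW(y)`. -/
def primWV {W V : ℝ → ℝ} (hW : Monotone W) (hV : Monotone V) (h : ℝ → ℝ) (x : ℝ) : ℝ :=
  ∫ y in Ioc 0 x, primV hV h y ∂(dMeas hW)

/-- `IsLaplacian hW hV f h` says that `f ∈ 𝒟_{W,V}(𝕋)` and `Δ_{W,V} f = h`: the function `h` has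
`dV`-mean zero, and
`f(x) = a + b (W(x) - W(0)) + ∫_{(0,x]} ∫_{[0,y)} h(s) dV(s) dW(y)` for `dV`-almost every `x`,
where `b (W(1) - W(0)) + ∫_{(0,1]} ∫_{[0,y)} h(s) dV(s) dW(y) = 0`. -/
def IsLaplacian {W V : ℝ → ℝ} (hW : Monotone W) (hV : Monotone V) (f h : L2 hV) : Prop :=
  (∫ s, h s ∂(torusMeas hV) = 0) ∧
    ∃ a b : ℝ,
      (∀ᵐ x ∂(torusMeas hV), f x = a + b * (W x - W 0) + primWV hW hV h x) ∧
      b * (W 1 - W 0) + primWV hW hV h 1 = 0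

section helpers

variable {W V : ℝ → ℝ} (hW : Monotone W) (hV : Monotone V)

theorem L2.integrable (h : L2 hV) : Integrable h (torusMeas hV) :=
  (Lp.memLp h).integrable (by norm_num)

theorem primV_eq (h : ℝ → ℝ) {y : ℝ} (hy : y ≤ 1) :
    primV hV h y = ∫ s in Iio y, h s ∂(torusMeas hV) := by
  rw [primV, torusMeas, Measure.restrict_restrict measurableSet_Iio]
  congr 2
  ext s
  simp only [mem_Ico, mem_inter_iff, mem_Iio]
  constructor
  · rintro ⟨h1, h2⟩; exact ⟨h2, h1, h2.trans_le hy⟩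
  · rintro ⟨h1, h2, _⟩; exact ⟨h2, h1⟩

theorem measurable_setIntegral_Iio (h : L2 hV) :
    StronglyMeasurable fun y : ℝ => ∫ s in Iio y, h s ∂(torusMeas hV) := by
  have : (fun y : ℝ => ∫ s in Iio y, h s ∂(torusMeas hV)) =
      fun y : ℝ => ∫ s, {p : ℝ × ℝ | p.2 < p.1}.indicator (fun p => h p.2) (y, s)
        ∂(torusMeas hV) := by
    funext y
    rw [← integral_indicator measurableSet_Iio]
    rfl
  rw [this]
  apply StronglyMeasurable.integral_prod_right'
  exact ((Lp.stronglyMeasurable h).comp_measurable measurable_snd).indicator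
    (measurableSet_lt measurable_snd measurable_fst)

theorem integrableOn_setIntegral_Iio (h : L2 hV) {x : ℝ} :
    IntegrableOn (fun y : ℝ => ∫ s in Iio y, h s ∂(torusMeas hV)) (Ioc 0 x) (dMeas hW) := by
  refine Measure.integrableOn_of_bounded (M := ∫ s, ‖h s‖ ∂(torusMeas hV)) ?_
    (measurable_setIntegral_Iio hV h).aestronglyMeasurable ?_
  · exact ((measure_mono Ioc_subset_Icc_self).trans_lt isCompact_Icc.measure_lt_top).ne
  · filter_upwards with y
    refine (norm_integral_le_integral_norm _).trans ?_
    exact setIntegral_le_integral (L2.integrable hV h).norm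
      (Eventually.of_forall fun _ => norm_nonneg _)

theorem primWV_eq (h : ℝ → ℝ) {x : ℝ} (hx : x ≤ 1) :
    primWV hW hV h x = ∫ y in Ioc 0 x, (∫ s in Iio y, h s ∂(torusMeas hV)) ∂(dMeas hW) := by
  apply setIntegral_congr_fun measurableSet_Ioc
  intro y hy
  exact primV_eq hV h (hy.2.trans hx)

theorem primWV_add (h k : L2 hV) {x : ℝ} (hx : x ≤ 1) :
    primWV hW hV (h + k : L2 hV) x = primWV hW hV h x + primWV hW hV k x := by
  rw [primWV_eq _ _ _ hx, primWV_eq _ _ _ hx, primWV_eq _ _ _ hx, ← integral_add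
    (integrableOn_setIntegral_Iio hW hV h) (integrableOn_setIntegral_Iio hW hV k)]
  congr 1
  funext y
  rw [← integral_add (L2.integrable hV h).integrableOn (L2.integrable hV k).integrableOn]
  exact integral_congr_ae (ae_restrict_of_ae (Lp.coeFn_add h k))

theorem primWV_smul (c : ℝ) (h : L2 hV) {x : ℝ} (hx : x ≤ 1) :
    primWV hW hV (c • h : L2 hV) x = c * primWV hW hV h x := by
  rw [primWV_eq _ _ _ hx, primWV_eq _ _ _ hx, ← integral_const_mul]
  congr 1
  funext y
  rw [← integral_const_mul]
  exact integral_congr_ae (ae_restrict_of_ae (Lp.coeFn_smul c h))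

theorem ae_torus_mem : ∀ᵐ x ∂(torusMeas hV), x ∈ Ico (0 : ℝ) 1 :=
  ae_restrict_mem measurableSet_Ico

end helpers

/-- The graph of `Δ_{W,V}` as a linear subspace of `L²_V(𝕋) × L²_V(𝕋)`. -/
def laplacianGraph {W V : ℝ → ℝ} (hW : Monotone W) (hV : Monotone V) :
    Submodule ℝ (L2 hV × L2 hV) where
  carrier := {p | IsLaplacian hW hV p.1 p.2}
  zero_mem' := by
    have h0 : ∀ᵐ s ∂(torusMeas hV), (0 : L2 hV) s = 0 := Lp.coeFn_zero ℝ 2 (torusMeas hV)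
    have hp : ∀ x ≤ (1 : ℝ), primWV hW hV (0 : L2 hV) x = 0 := by
      intro x hx
      have := primWV_smul hW hV 0 (0 : L2 hV) hx
      simpa using this
    refine ⟨?_, 0, 0, ?_, ?_⟩
    · simpa using integral_congr_ae h0
    · filter_upwards [h0, ae_torus_mem hV] with x hx hx1
      have := hp x hx1.2.le
      simp_all
    · simpa using hp 1 le_rfl
  add_mem' := by
    rintro ⟨f, h⟩ ⟨g, k⟩ ⟨h1, a, b, h2, h3⟩ ⟨k1, c, d, k2, k3⟩
    refine ⟨?_, a + c, b + d, ?_, ?_⟩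
    · have := integral_congr_ae (Lp.coeFn_add h k)
      simp only [Pi.add_apply] at this
      rw [integral_add (L2.integrable hV h) (L2.integrable hV k)] at this
      change ∫ s, (h + k : L2 hV) s ∂(torusMeas hV) = 0
      simp only at h1 k1
      rw [this, h1, k1, add_zero]
    · filter_upwards [h2, k2, ae_torus_mem hV, Lp.coeFn_add f g] with x hx kx hx1 hfg
      change (f + g : L2 hV) x = _ + primWV hW hV (h + k : L2 hV) x
      rw [hfg, primWV_add hW hV h k hx1.2.le, Pi.add_apply, hx, kx]
      ring
    · change _ + primWV hW hV (h + k : L2 hV) 1 = 0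
      rw [primWV_add hW hV h k le_rfl]
      simp only at h3 k3
      linarith
  smul_mem' := by
    rintro c ⟨f, h⟩ ⟨h1, a, b, h2, h3⟩
    refine ⟨?_, c * a, c * b, ?_, ?_⟩
    · have := integral_congr_ae (Lp.coeFn_smul c h)
      simp only [Pi.smul_apply, smul_eq_mul] at this
      rw [integral_const_mul] at this
      change ∫ s, (c • h : L2 hV) s ∂(torusMeas hV) = 0
      simp only at h1
      rw [this, h1, mul_zero]
    · filter_upwards [h2, ae_torus_mem hV, Lp.coeFn_smul c f] with x hx hx1 hcf
      change (c • f : L2 hV) x = _ + primWV hW hV (c • h : L2 hV) x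
      rw [hcf, primWV_smul hW hV c h hx1.2.le, Pi.smul_apply, hx, smul_eq_mul]
      ring
    · change _ + primWV hW hV (c • h : L2 hV) 1 = 0
      rw [primWV_smul hW hV c h le_rfl]
      simp only at h3
      linear_combination c * h3

section singleValued

theorem tendsto_setIntegral_Iio {μ : Measure ℝ} {φ : ℝ → ℝ} (hφ : Integrable φ μ) (y : ℝ) :
    Tendsto (fun z => ∫ s in Iio z, φ s ∂μ) (𝓝[<] y) (𝓝 (∫ s in Iio y, φ s ∂μ)) := by
  simp_rw [← integral_indicator measurableSet_Iio]
  refine tendsto_integral_filter_of_dominated_convergence (fun s => ‖φ s‖) ?_ ?_ hφ.norm ?_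
  · exact Eventually.of_forall fun z =>
      (hφ.indicator measurableSet_Iio).aestronglyMeasurable
  · exact Eventually.of_forall fun z => Eventually.of_forall fun s =>
      norm_indicator_le_norm_self _ _
  · refine Eventually.of_forall fun s => ?_
    apply tendsto_const_nhds.congr'
    by_cases hs : s < y
    · filter_upwards [Ioo_mem_nhdsLT hs] with z hz
      simp [indicator, hs, hz.1]
    · filter_upwards [self_mem_nhdsWithin] with z hz
      have hz' : z < y := hz
      have : ¬ s < z := fun h => hs (h.trans hz')
      simp [indicator, hs, this]

theorem tendsto_setIntegral_Iic {μ : Measure ℝ} {φ : ℝ → ℝ} (hφ : Integrable φ μ) (y : ℝ) :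
    Tendsto (fun z => ∫ s in Iic z, φ s ∂μ) (𝓝[>] y) (𝓝 (∫ s in Iic y, φ s ∂μ)) := by
  simp_rw [← integral_indicator measurableSet_Iic]
  refine tendsto_integral_filter_of_dominated_convergence (fun s => ‖φ s‖) ?_ ?_ hφ.norm ?_
  · exact Eventually.of_forall fun z =>
      (hφ.indicator measurableSet_Iic).aestronglyMeasurable
  · exact Eventually.of_forall fun z => Eventually.of_forall fun s =>
      norm_indicator_le_norm_self _ _
  · refine Eventually.of_forall fun s => ?_
    apply tendsto_const_nhds.congr'
    by_cases hs : s ≤ y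
    · filter_upwards [self_mem_nhdsWithin] with z hz
      have hz' : y < z := hz
      simp [indicator, hs, hs.trans hz'.le]
    · filter_upwards [Ioo_mem_nhdsGT (not_le.1 hs)] with z hz
      have : ¬ s ≤ z := not_le.2 hz.2
      simp [indicator, hs, this]

theorem ae_zero_of_setIntegral {μ : Measure ℝ} [IsFiniteMeasure μ] {φ : ℝ → ℝ}
    (hφ : Integrable φ μ) {S : Set (Set ℝ)} (hS : borel ℝ = MeasurableSpace.generateFrom S)
    (hpi : IsPiSystem S) (hz : ∀ t ∈ S, ∫ s in t, φ s ∂μ = 0) (h1 : ∫ s, φ s ∂μ = 0) :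
    φ =ᵐ[μ] 0 := by
  apply ae_eq_zero_of_forall_setIntegral_eq_of_sigmaFinite (fun _ _ _ => hφ.integrableOn)
  intro t ht _
  induction t, ht using MeasurableSpace.induction_on_inter
    ((BorelSpace.measurable_eq (α := ℝ)).trans hS) hpi with
  | empty => simp
  | basic t ht => exact hz t ht
  | compl t htm ih => rw [setIntegral_compl htm hφ, ih (measure_lt_top _ _), h1, sub_zero]
  | iUnion f hd hm ih =>
    rw [integral_iUnion hm hd hφ.integrableOn]
    simp [fun i => ih i (measure_lt_top _ _)]

theorem dMeas_Ioo_pos {F : ℝ → ℝ} (hF : StrictMono F) {p q : ℝ} (hpq : p < q) :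
    0 < dMeas hF.monotone (Ioo p q) := by
  obtain ⟨r, hr⟩ := exists_between hpq
  obtain ⟨t, ht⟩ := exists_between hr.2
  refine lt_of_lt_of_le ?_ (measure_mono (Ioc_subset_Ioo_right ht.2 : Ioc p t ⊆ _))
  rw [dMeas, StieltjesFunction.measure_Ioc, ENNReal.ofReal_pos, sub_pos]
  rw [Monotone.stieltjesFunction_eq, Monotone.stieltjesFunction_eq]
  exact (hF.monotone.rightLim_le hr.1).trans_lt
    ((hF ht.1).trans_le (hF.monotone.le_rightLim le_rfl))

/-- `Δ_{W,V}` is single-valued: if `f = 0` in `L²_V(𝕋)` then `Δ_{W,V} f = 0`. -/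
theorem laplacian_unique {W V : ℝ → ℝ} (hW : StrictMono W) (hV : StrictMono V)
    (hr : ∀ x, ContinuousWithinAt W (Ioi x) x) {h : L2 hV.monotone}
    (hh : IsLaplacian hW.monotone hV.monotone 0 h) : h = 0 := by
  obtain ⟨h1, a, b, h2, h3⟩ := hh
  set μ := torusMeas hV.monotone with hμ
  set ν := (dMeas hW.monotone).restrict (Ioc 0 1) with hν
  have : IsFiniteMeasure ν := ⟨by
    rw [hν, Measure.restrict_apply_univ]
    exact (measure_mono Ioc_subset_Icc_self).trans_lt isCompact_Icc.measure_lt_top⟩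
  have hhi := L2.integrable hV.monotone h
  set g : ℝ → ℝ := fun y => b + ∫ s in Iio y, h s ∂μ with hg
  have hH : Integrable (fun y : ℝ => ∫ s in Iio y, h s ∂μ) ν :=
    integrableOn_setIntegral_Iio hW.monotone hV.monotone h
  have hgi : Integrable g ν := (integrable_const b).add hH
  have hint : ∀ x ∈ Icc (0 : ℝ) 1,
      b * (W x - W 0) + primWV hW.monotone hV.monotone h x = ∫ y in Iic x, g y ∂ν := by
    intro x hx
    have hset : ν.restrict (Iic x) = (dMeas hW.monotone).restrict (Ioc 0 x) := by
      rw [hν, Measure.restrict_restrict measurableSet_Iic]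
      congr 1
      ext s
      simp only [mem_inter_iff, mem_Iic, mem_Ioc]
      exact ⟨fun h => ⟨h.2.1, h.1⟩, fun h => ⟨h.2, h.1, h.2.trans hx.2⟩⟩
    rw [hg, integral_add (integrable_const b) hH.integrableOn, primWV_eq _ _ _ hx.2, hset]
    congr 1
    rw [setIntegral_const, measureReal_def, dMeas_Ioc _ hr,
      ENNReal.toReal_ofReal (sub_nonneg.2 (hW.monotone hx.1)), smul_eq_mul, mul_comm]
  have hae : ∀ᵐ x ∂(dMeas hV.monotone), x ∈ Ico (0 : ℝ) 1 → a + ∫ y in Iic x, g y ∂ν = 0 := by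
    rw [← ae_restrict_iff' measurableSet_Ico]
    have h0 : ∀ᵐ s ∂μ, (0 : L2 hV.monotone) s = 0 := Lp.coeFn_zero ℝ 2 μ
    filter_upwards [h2, h0, ae_torus_mem hV.monotone] with x hx hx0 hx1
    rw [← hint x ⟨hx1.1, hx1.2.le⟩, ← add_assoc, ← hx, hx0]
  have hu : ∀ x ∈ Ico (0 : ℝ) 1, a + ∫ y in Iic x, g y ∂ν = 0 := by
    intro x hx
    have ht : Tendsto (fun z => a + ∫ y in Iic z, g y ∂ν) (𝓝[>] x)
      (𝓝 (a + ∫ y in Iic x, g y ∂ν)) := (tendsto_setIntegral_Iic hgi x).const_add a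
    refine isClosed_singleton.mem_of_frequently_of_tendsto (s := {(0 : ℝ)}) ?_ ht
    intro hcon
    obtain ⟨q, hq, hq'⟩ := (mem_nhdsGT_iff_exists_Ioo_subset' hx.2).1
      (inter_mem hcon (Ioo_mem_nhdsGT hx.2))
    refine (dMeas_Ioo_pos hV hq).ne' (measure_mono_null ?_ hae)
    intro z hz
    have h5 := hq' hz
    exact fun h6 => h5.1 (h6 ⟨hx.1.trans h5.2.1.le, h5.2.2⟩)
  have ha : a = 0 := by
    have h5 := hu 0 ⟨le_rfl, one_pos⟩
    rw [← hint 0 ⟨le_rfl, zero_le_one⟩] at h5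
    simpa [primWV] using h5
  have hν1 : ∫ y, g y ∂ν = 0 := by
    have h5 := hint 1 ⟨zero_le_one, le_rfl⟩
    rw [h3, hν, Measure.restrict_restrict measurableSet_Iic] at h5
    have : Iic (1 : ℝ) ∩ Ioc 0 1 = Ioc 0 1 := inter_eq_right.2 fun s hs => hs.2
    rw [this] at h5
    exact h5.symm
  have hg0 : g =ᵐ[ν] 0 := by
    refine ae_zero_of_setIntegral hgi (borel_eq_generateFrom_Iic ℝ) isPiSystem_Iic ?_ hν1
    rintro _ ⟨x, rfl⟩
    rcases lt_or_ge x 0 with hx | hx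
    · have : ν.restrict (Iic x) = 0 := by
        rw [hν, Measure.restrict_restrict measurableSet_Iic, Measure.restrict_eq_zero]
        rw [show Iic x ∩ Ioc (0 : ℝ) 1 = ∅ from ?_, measure_empty]
        ext s
        simp only [mem_inter_iff, mem_Iic, mem_Ioc, mem_empty_iff_false, iff_false]
        rintro ⟨h5, h6, _⟩
        linarith
      rw [this, integral_zero_measure]
    · rcases lt_or_ge x 1 with hx' | hx'
      · simpa [ha] using hu x ⟨hx, hx'⟩
      · have : ν.restrict (Iic x) = ν := by
          rw [hν, Measure.restrict_restrict measurableSet_Iic]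
          congr 1
          exact inter_eq_right.2 fun s hs => hs.2.trans hx'
        rw [this, hν1]
  have hg0' : ∀ᵐ y ∂(dMeas hW.monotone), y ∈ Ioc (0 : ℝ) 1 → g y = 0 := by
    rwa [← ae_restrict_iff' measurableSet_Ioc]
  have hg1 : ∀ y ∈ Ioc (0 : ℝ) 1, g y = 0 := by
    intro y hy
    have ht : Tendsto g (𝓝[<] y) (𝓝 (g y)) := (tendsto_setIntegral_Iio hhi y).const_add b
    refine isClosed_singleton.mem_of_frequently_of_tendsto (s := {(0 : ℝ)}) ?_ ht
    intro hcon
    obtain ⟨q, hq, hq'⟩ := (mem_nhdsLT_iff_exists_Ioo_subset' hy.1).1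
      (inter_mem hcon (Ioo_mem_nhdsLT hy.1))
    refine (dMeas_Ioo_pos hW hq).ne' (measure_mono_null ?_ hg0')
    intro z hz
    have h5 := hq' hz
    exact fun h6 => h5.1 (h6 ⟨h5.2.1, h5.2.2.le.trans hy.2⟩)
  have hfull : ∀ x ≥ (1 : ℝ), μ.restrict (Iio x) = μ := by
    intro x hx
    rw [hμ, torusMeas, Measure.restrict_restrict measurableSet_Iio]
    congr 1
    exact inter_eq_right.2 fun s hs => hs.2.trans_le hx
  have hb : b = 0 := by
    have h5 := hg1 1 ⟨one_pos, le_rfl⟩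
    simp only [hg] at h5
    rwa [hfull 1 le_rfl, h1, add_zero] at h5
  have hfin : h =ᵐ[μ] 0 := by
    refine ae_zero_of_setIntegral hhi (borel_eq_generateFrom_Iio ℝ) isPiSystem_Iio ?_ h1
    rintro _ ⟨x, rfl⟩
    rcases le_or_gt x 0 with hx | hx
    · have : μ.restrict (Iio x) = 0 := by
        rw [hμ, torusMeas, Measure.restrict_restrict measurableSet_Iio, Measure.restrict_eq_zero]
        rw [show Iio x ∩ Ico (0 : ℝ) 1 = ∅ from ?_, measure_empty]
        ext s
        simp only [mem_inter_iff, mem_Iio, mem_Ico, mem_empty_iff_false, iff_false]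
        rintro ⟨h5, h6, _⟩
        linarith
      rw [this, integral_zero_measure]
    · rcases le_or_gt x 1 with hx' | hx'
      · simpa [hg, hb] using hg1 x ⟨hx, hx'⟩
      · rw [hfull x hx'.le, h1]
  exact (Lp.eq_zero_iff_ae_eq_zero).2 hfin

end singleValued

/-- The `W`-`V`-Laplacian `Δ_{W,V} : 𝒟_{W,V}(𝕋) ⊆ L²_V(𝕋) → L²_V(𝕋)`, the unbounded operator whose
graph is `laplacianGraph` (see `laplacian_graph`). -/
def laplacian {W V : ℝ → ℝ} (hW : Monotone W) (hV : Monotone V) : L2 hV →ₗ.[ℝ] L2 hV :=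
  (laplacianGraph hW hV).toLinearPMap

theorem laplacian_graph {W V : ℝ → ℝ} (hW : StrictMono W) (hV : StrictMono V)
    (hr : ∀ x, ContinuousWithinAt W (Ioi x) x) :
    (laplacian hW.monotone hV.monotone).graph = laplacianGraph hW.monotone hV.monotone := by
  apply Submodule.toLinearPMap_graph_eq
  rintro ⟨f, h⟩ hfh hf
  simp only at hf
  subst hf
  exact laplacian_unique hW hV hr hfh

/-- The eigenspace `{f ∈ 𝒟_{W,V}(𝕋) : -Δ_{W,V} f = μ f}`, see `mem_eigenspace`. -/
def eigenspace {W V : ℝ → ℝ} (hW : Monotone W) (hV : Monotone V) (μ : ℝ) :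
    Submodule ℝ (L2 hV) :=
  (laplacian hW hV).graph.comap (LinearMap.prod LinearMap.id (-μ • LinearMap.id))

theorem mem_eigenspace {W V : ℝ → ℝ} (hW : Monotone W) (hV : Monotone V) (μ : ℝ) (f : L2 hV) :
    f ∈ eigenspace hW hV μ ↔
      ∃ hf : f ∈ (laplacian hW hV).domain, -(laplacian hW hV ⟨f, hf⟩) = μ • f := by
  rw [eigenspace, Submodule.mem_comap, LinearPMap.mem_graph_iff]
  constructor
  · rintro ⟨⟨y, hy⟩, h1, h2⟩
    simp only [LinearMap.prod_apply, LinearMap.id_coe] at h1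
    subst h1
    exact ⟨hy, by rw [h2]; simp⟩
  · rintro ⟨hf, h⟩
    refine ⟨⟨f, hf⟩, rfl, ?_⟩
    rw [← neg_neg (laplacian hW hV ⟨f, hf⟩), h]
    simp

/-- `lam 0 ≤ lam 1 ≤ lam 2 ≤ …` lists all eigenvalues of `-Δ_{W,V}`, each one repeated as many
times as the dimension of its eigenspace, and nothing else. -/
def IsEigenvalueSequence {W V : ℝ → ℝ} (hW : Monotone W) (hV : Monotone V) (lam : ℕ → ℝ) : Prop :=
  Monotone lam ∧
    ∀ μ : ℝ, Module.rank ℝ (eigenspace hW hV μ) = Cardinal.mk {n : ℕ // lam n = μ}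

end WVLaplacian

end

/-!
The exponent `ρ = 1/2` works for all `W` and `V`, so the eigenvalues of `-Δ_{W,V}` are to be bounded
below by `C n²`.

Let `μ` be `dV` on `[0, 1)`, let `ν` be `dW` on `(0, 1]`, and let `A : L²(μ) → L²(ν)` be the
Volterra operator `(A u)(y) = ∫_{[0, y)} u dμ`. By Fubini, `(A† g)(x) = ∫_{(x, 1]} g dν`. With `P`
the projection onto the functions of mean zero, the definition of the Laplacian reads: `Δ f = h` if and
only if `h` has mean zero and `f = c - A† P A h` for a constant `c` (`isLaplacian_iff`). Hence for
`x ≠ 0` the eigenspace of `-Δ` for `x` is that of the Green operator `G = P A† P A P` for `x⁻¹`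
(`eigenspace_eq_eigenspace_greenOp`), and for `x = 0` it consists of the constants, which also
contain the kernel of `G` because `Δ` is single-valued.

The decisive estimate is `norm_volterra_le`. The line is cut into the `n` level sets of a monotone
function that measures `μ` and `ν` simultaneously and counts an atom both just before and just after
its position. Each level set is then an interval which is either a single point, possibly a heavy
atom, or has `μ`- and `ν`-measure at most `M / n`. If `u` has mean zero on every level set, then
`A u` at `y` is an integral over the part of the level set of `y` to the left of `y`. This part is
empty for a single point, and otherwise the Cauchy–Schwarz inequality applies, so that
`‖A u‖ ≤ (M / n) ‖u‖` on a subspace of codimension at most `n`.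

Thus `A` is a norm limit of operators of finite rank, `G` is compact, and the spectral theorem
provides the eigenvalues; there are infinitely many of them because `L²(μ)` has infinite dimension.
By the min-max principle the `n`-th eigenvalue of `G` is `O(n⁻²)`
(`eigenvalue_sequence_lower_bound`). For `W(x) = V(x) = x` the functions `cos (2πkx)` give the
opposite inequality (`eigenvalue_lebesgue_le`).
-/

noncomputable section

namespace WVLaplacian

/-! ### Enumerating a discrete set with multiplicities -/

/-- A multiplicity function on `ℝ` with infinite support, only finitely much of it below any given
bound, is the multiplicity function of a nondecreasing sequence: the pairs `(x, i)` with `i < d x`,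
ordered lexicographically, form an order isomorphic to `ℕ`. -/
theorem exists_monotone_enumeration (d : ℝ → ℕ) (hfin : ∀ t, {x | x ≤ t ∧ d x ≠ 0}.Finite)
    (hinf : {x | d x ≠ 0}.Infinite) :
    ∃ lam : ℕ → ℝ, Monotone lam ∧ ∀ x, Cardinal.mk {n // lam n = x} = d x := by
  classical
  let α := {p : ℝ ×ₗ ℕ // (ofLex p).2 < d (ofLex p).1}
  have hle : ∀ {a b : α}, a ≤ b → (ofLex a.1).1 ≤ (ofLex b.1).1 := by
    intro a b hab
    exact Prod.Lex.monotone_fst_ofLex hab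
  -- initial segments are finite, which makes `α` a locally finite order with a least element
  have hIic : ∀ a : α, (Iic a).Finite := by
    intro a
    have h1 : (⋃ x ∈ {x | x ≤ (ofLex a.1).1 ∧ d x ≠ 0}, ({x} : Set ℝ) ×ˢ Iio (d x)).Finite :=
      (hfin _).biUnion fun x _ => (finite_singleton x).prod (finite_Iio _)
    refine (h1.preimage (f := fun p : α => ofLex p.1) ?_).subset ?_
    · exact fun p _ q _ h => Subtype.ext (ofLex.injective h)
    · intro b hb
      simp only [mem_preimage, mem_iUnion, mem_prod, mem_singleton_iff, mem_Iio]
      exact ⟨_, ⟨hle hb, (Nat.zero_le _).trans_lt b.2 |>.ne'⟩, rfl, b.2⟩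
  have hne : ∀ {x : ℝ}, d x ≠ 0 → ∃ a : α, (ofLex a.1).1 = x := fun {x} hx =>
    ⟨⟨toLex (x, 0), Nat.pos_of_ne_zero hx⟩, rfl⟩
  let : LocallyFiniteOrder α :=
    LocallyFiniteOrder.ofFiniteIcc fun a b => (hIic b).subset Icc_subset_Iic_self
  let : SuccOrder α := LinearLocallyFiniteOrder.succOrder α
  let : PredOrder α := LinearLocallyFiniteOrder.predOrder α
  have : Nonempty α := by
    obtain ⟨x, hx⟩ := hinf.nonempty
    exact ⟨(hne hx).choose⟩
  obtain ⟨b0, hb0⟩ : ∃ b0 : α, ∀ a, b0 ≤ a := by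
    obtain ⟨a⟩ := (inferInstance : Nonempty α)
    obtain ⟨b, hb, hmin⟩ := (hIic a).exists_minimal ⟨a, self_mem_Iic⟩
    refine ⟨b, fun c => (le_total b c).elim id fun hcb => hmin (hcb.trans hb) hcb⟩
  let : OrderBot α := { bot := b0, bot_le := hb0 }
  have : NoMaxOrder α := by
    refine ⟨fun a => ?_⟩
    by_contra! hcon
    refine hinf ((hfin (ofLex a.1).1).subset fun x hx => ⟨?_, hx⟩)
    obtain ⟨b, rfl⟩ := hne hx
    exact hle (not_lt.1 (hcon b))
  let e : α ≃o ℕ := orderIsoNatOfLinearSuccPredArch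
  refine ⟨fun n => (ofLex (e.symm n).1).1, fun m n hmn => hle (e.symm.monotone hmn), fun x => ?_⟩
  have : {n // (ofLex (e.symm n).1).1 = x} ≃ Fin (d x) :=
    { toFun := fun n => ⟨(ofLex (e.symm n.1).1).2, by
        have := (e.symm n.1).2
        rwa [n.2] at this⟩
      invFun := fun i => ⟨e ⟨toLex (x, i), i.2⟩, by simp⟩
      left_inv := by
        rintro ⟨n, rfl⟩
        apply Subtype.ext
        apply e.symm.injective
        simp only [OrderIso.symm_apply_apply]
        exact Subtype.ext rfl
      right_inv := fun i => by simp }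
  rw [Cardinal.mk_congr this, Cardinal.mk_fin]

/-! ### Eigenvalue counting for compact positive operators -/

section Hilbert

open Module

variable {H : Type} [NormedAddCommGroup H] [InnerProductSpace ℝ H]

/-- A subspace that meets the orthogonal complement of `S` trivially projects injectively to `S`. -/
theorem finrank_le_of_inf_orthogonal (E S : Submodule ℝ H) [FiniteDimensional ℝ S]
    (h : ∀ u ∈ E, u ∈ Sᗮ → u = 0) : FiniteDimensional ℝ E ∧ finrank ℝ E ≤ finrank ℝ S := by
  have hinj : Function.Injective ((S.orthogonalProjectionOnto : H →ₗ[ℝ] S).comp E.subtype) := by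
    rw [← LinearMap.ker_eq_bot, LinearMap.ker_eq_bot']
    intro u hu
    apply Subtype.ext
    refine h u u.2 ?_
    rw [← S.orthogonalProjectionOnto_eq_zero_iff]
    exact hu
  exact ⟨FiniteDimensional.of_injective _ hinj, LinearMap.finrank_le_finrank_of_injective hinj⟩

variable {G : H →L[ℝ] H} {M : ℝ}

/-- The sum of the eigenspaces of `G` with eigenvalue at least `t`. -/
def upperEigensum (G : H →L[ℝ] H) (t : ℝ) : Submodule ℝ H :=
  ⨆ κ : {κ : ℝ // t ≤ κ}, End.eigenspace (G : End ℝ H) κ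

theorem mem_upperEigensum {t κ : ℝ} (h : t ≤ κ) {u : H} (hu : G u = κ • u) :
    u ∈ upperEigensum G t :=
  Submodule.mem_iSup_of_mem (⟨κ, h⟩ : {κ : ℝ // t ≤ κ}) (End.mem_eigenspace_iff.2 hu)

theorem inner_eq_zero_of_eigenvalue_ne (hG : (G : H →ₗ[ℝ] H).IsSymmetric) {a b : ℝ} (hab : a ≠ b)
    {u v : H} (hu : G u = a • u) (hv : G v = b • v) : inner ℝ u v = 0 := by
  have h : inner ℝ (G u) v = inner ℝ u (G v) := hG u v
  rw [hu, hv, real_inner_smul_left, real_inner_smul_right, ← sub_eq_zero, ← sub_mul] at h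
  exact (mul_eq_zero.1 h).resolve_left (sub_ne_zero.2 hab)

/-- The quadratic form of a symmetric operator on a sum of eigenspaces, by their orthogonality. -/
theorem le_inner_of_mem_upperEigensum (hG : (G : H →ₗ[ℝ] H).IsSymmetric) {t : ℝ} {u : H}
    (hu : u ∈ upperEigensum G t) : t * ‖u‖ ^ 2 ≤ inner ℝ (G u) u := by
  obtain ⟨f, hf, rfl⟩ := (Submodule.mem_iSup_iff_exists_finsupp _ _).1 hu
  have horth : OrthogonalFamily ℝ (fun κ : {κ : ℝ // t ≤ κ} => End.eigenspace (G : End ℝ H) κ)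
      fun κ => (End.eigenspace (G : End ℝ H) κ).subtypeₗᵢ :=
    hG.orthogonalFamily_eigenspaces.comp Subtype.val_injective
  let v : ∀ κ : {κ : ℝ // t ≤ κ}, End.eigenspace (G : End ℝ H) κ := fun κ => ⟨f κ, hf κ⟩
  have hGf : ∀ κ : {κ : ℝ // t ≤ κ}, G (f κ) = κ.1 • f κ := fun κ => End.mem_eigenspace_iff.1 (hf κ)
  have h1 : ‖∑ i ∈ f.support, f i‖ ^ 2 = ∑ i ∈ f.support, ‖f i‖ ^ 2 :=
    horth.norm_sum v f.support
  have h2 : inner ℝ (∑ i ∈ f.support, i.1 • f i) (∑ i ∈ f.support, f i) =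
      ∑ i ∈ f.support, inner ℝ (i.1 • f i) (f i) :=
    horth.inner_sum (fun i => i.1 • v i) v f.support
  change t * ‖∑ i ∈ f.support, f i‖ ^ 2 ≤ inner ℝ (G (∑ i ∈ f.support, f i)) (∑ i ∈ f.support, f i)
  rw [map_sum, Finset.sum_congr rfl fun i _ => hGf i, h1, h2, Finset.mul_sum]
  refine Finset.sum_le_sum fun i _ => ?_
  rw [real_inner_smul_left, real_inner_self_eq_norm_sq]
  exact mul_le_mul_of_nonneg_right i.2 (sq_nonneg _)

/-- `G` has quadratic form at most `(M / n)²` on a subspace of codimension at most `n`, for every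
`n ≥ 1`. By the min-max principle its `n`-th eigenvalue is then `O(n⁻²)`. -/
def QuadraticDecay (G : H →L[ℝ] H) (M : ℝ) : Prop :=
  ∀ n : ℕ, 1 ≤ n → ∃ S : Submodule ℝ H, FiniteDimensional ℝ S ∧ finrank ℝ S ≤ n ∧
    ∀ u ∈ Sᗮ, inner ℝ (G u) u ≤ (M / n) ^ 2 * ‖u‖ ^ 2

theorem QuadraticDecay.finrank_upperEigensum (hM : QuadraticDecay G M)
    (hG : (G : H →ₗ[ℝ] H).IsSymmetric) {t : ℝ} {n : ℕ} (hn : 1 ≤ n) (ht : (M / n) ^ 2 < t) :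
    FiniteDimensional ℝ (upperEigensum G t) ∧ finrank ℝ (upperEigensum G t) ≤ n := by
  obtain ⟨S, hS, hSn, h⟩ := hM n hn
  have := finrank_le_of_inf_orthogonal (upperEigensum G t) S fun u hu huS => by
    by_contra hne
    have h1 := le_inner_of_mem_upperEigensum hG hu
    have h2 := h u huS
    have h3 : 0 < ‖u‖ ^ 2 := by positivity
    nlinarith
  exact ⟨this.1, this.2.trans hSn⟩

theorem QuadraticDecay.finiteDimensional_upperEigensum (hM : QuadraticDecay G M)
    (hG : (G : H →ₗ[ℝ] H).IsSymmetric) {t : ℝ} (ht : 0 < t) :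
    FiniteDimensional ℝ (upperEigensum G t) := by
  have h1 : Tendsto (fun n : ℕ => (M / n) ^ 2) atTop (𝓝 (0 ^ 2)) :=
    (tendsto_const_div_atTop_nhds_zero_nat M).pow 2
  rw [zero_pow two_ne_zero] at h1
  obtain ⟨n, hn, hn1⟩ := ((h1.eventually (gt_mem_nhds ht)).and (eventually_ge_atTop 1)).exists
  exact (hM.finrank_upperEigensum hG hn1 hn).1

theorem QuadraticDecay.finite_eigenvalues (hM : QuadraticDecay G M)
    (hG : (G : H →ₗ[ℝ] H).IsSymmetric) {t : ℝ} (ht : 0 < t) :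
    {κ | t ≤ κ ∧ End.eigenspace (G : End ℝ H) κ ≠ ⊥}.Finite := by
  have := hM.finiteDimensional_upperEigensum hG ht
  have hex : ∀ κ : {κ | t ≤ κ ∧ End.eigenspace (G : End ℝ H) κ ≠ ⊥},
      ∃ v : H, End.HasEigenvector (G : End ℝ H) κ.1 v := fun κ =>
    End.HasEigenvalue.exists_hasEigenvector κ.2.2
  let v : {κ | t ≤ κ ∧ End.eigenspace (G : End ℝ H) κ ≠ ⊥} → H := fun κ => (hex κ).choose
  have hv : ∀ κ, End.HasEigenvector (G : End ℝ H) κ.1 (v κ) := fun κ => (hex κ).choose_spec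
  have hli : LinearIndependent ℝ v :=
    End.eigenvectors_linearIndependent' (G : End ℝ H) Subtype.val Subtype.val_injective v hv
  have hli' : LinearIndependent ℝ fun κ =>
      (⟨v κ, mem_upperEigensum κ.2.1 (hv κ).apply_eq_smul⟩ : upperEigensum G t) :=
    LinearIndependent.of_comp (upperEigensum G t).subtype hli
  exact finite_coe_iff.1 hli'.finite_of_isNoetherian

/-- By the spectral theorem, a compact symmetric operator with finite-dimensional kernel on an
infinite-dimensional space has infinitely many eigenvalues. -/
theorem infinite_nonzero_eigenvalues [CompleteSpace H] (hGc : IsCompactOperator G)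
    (hG : (G : H →ₗ[ℝ] H).IsSymmetric) (hker : FiniteDimensional ℝ (End.eigenspace (G : End ℝ H) 0))
    (hH : ¬ FiniteDimensional ℝ H) :
    {κ | κ ≠ 0 ∧ End.eigenspace (G : End ℝ H) κ ≠ ⊥}.Infinite := by
  intro hfin
  have hfd : ∀ κ, FiniteDimensional ℝ (End.eigenspace (G : End ℝ H) κ) := fun κ => by
    rcases eq_or_ne κ 0 with rfl | h
    · exact hker
    · exact G.finite_dimensional_eigenspace hGc κ h
  have hle : (⨆ κ, End.eigenspace (G : End ℝ H) κ) ≤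
      ⨆ κ ∈ insert 0 hfin.toFinset, End.eigenspace (G : End ℝ H) κ := by
    refine iSup_le fun κ => ?_
    by_cases h : κ ∈ insert 0 hfin.toFinset
    · exact le_biSup (fun κ => End.eigenspace (G : End ℝ H) κ) h
    · simp only [Finset.mem_insert, Finite.mem_toFinset, mem_ofPred_eq, not_or, not_and,
        not_not] at h
      rw [h.2 h.1]
      exact bot_le
  have hfd' : FiniteDimensional ℝ (⨆ κ, End.eigenspace (G : End ℝ H) κ : Submodule ℝ H) := by
    have : FiniteDimensional ℝ
        (⨆ κ ∈ insert 0 hfin.toFinset, End.eigenspace (G : End ℝ H) κ : Submodule ℝ H) :=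
      by
        rw [← Finset.sup_eq_iSup]
        exact Submodule.finiteDimensional_finset_sup _ _
    exact Submodule.finiteDimensional_of_le hle
  have htop := G.orthogonalComplement_iSup_eigenspaces_eq_bot hGc hG
  rw [Submodule.orthogonal_eq_bot_iff] at htop
  rw [htop] at hfd'
  exact hH (Module.Finite.equiv (Submodule.topEquiv (R := ℝ) (M := H)))

section Sequence

variable {E : ℝ → Submodule ℝ H}

theorem eq_bot_of_neg (hnn : ∀ u, 0 ≤ inner ℝ (G u) u)
    (hE : ∀ x ≠ 0, E x = End.eigenspace (G : End ℝ H) x⁻¹) {x : ℝ} (hx : x < 0) : E x = ⊥ := by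
  rw [hE x hx.ne, Submodule.eq_bot_iff]
  intro u hu
  have h1 : G u = x⁻¹ • u := End.mem_eigenspace_iff.1 hu
  have h2 := hnn u
  rw [h1, real_inner_smul_left, real_inner_self_eq_norm_sq] at h2
  by_contra hne
  have h3 : 0 < ‖u‖ ^ 2 := by positivity
  have h4 : x⁻¹ < 0 := inv_lt_zero.2 hx
  nlinarith

/-- The reciprocals of the nonzero eigenvalues of a positive compact operator `G`, together with a
simple eigenvalue `0`, can be listed with multiplicity as a nondecreasing sequence. -/
theorem exists_eigenvalue_sequence [CompleteSpace H] (hM : QuadraticDecay G M)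
    (hGc : IsCompactOperator G) (hG : (G : H →ₗ[ℝ] H).IsSymmetric)
    (hnn : ∀ u, 0 ≤ inner ℝ (G u) u)
    (hker : FiniteDimensional ℝ (End.eigenspace (G : End ℝ H) 0)) (hH : ¬ FiniteDimensional ℝ H)
    (hE : ∀ x ≠ 0, E x = End.eigenspace (G : End ℝ H) x⁻¹) (hE0 : Module.rank ℝ (E 0) = 1) :
    ∃ lam : ℕ → ℝ, Monotone lam ∧
      ∀ x, Module.rank ℝ (E x) = Cardinal.mk {n : ℕ // lam n = x} := by
  have hfd : ∀ x, FiniteDimensional ℝ (E x) := fun x => by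
    rcases eq_or_ne x 0 with rfl | h
    · exact Module.finite_of_rank_eq_one hE0
    · rw [hE x h]
      exact G.finite_dimensional_eigenspace hGc _ (inv_ne_zero h)
  have hd : ∀ x, finrank ℝ (E x) ≠ 0 ↔ E x ≠ ⊥ := fun x => Submodule.finrank_eq_zero.not
  suffices h : (∀ t, {x | x ≤ t ∧ finrank ℝ (E x) ≠ 0}.Finite) ∧
      {x | finrank ℝ (E x) ≠ 0}.Infinite by
    obtain ⟨lam, hmono, hlam⟩ := exists_monotone_enumeration _ h.1 h.2
    refine ⟨lam, hmono, fun x => ?_⟩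
    rw [hlam, finrank_eq_rank]
  constructor
  · intro t
    rcases lt_or_ge 0 t with ht | ht
    · have h1 := (hM.finite_eigenvalues hG (inv_pos.2 ht)).image (fun κ => κ⁻¹)
      refine (h1.insert 0).subset ?_
      rintro x ⟨hxt, hx⟩
      rcases lt_trichotomy x 0 with h | h | h
      · exact absurd (eq_bot_of_neg hnn hE h) ((hd x).1 hx)
      · exact Or.inl h
      · refine Or.inr ⟨x⁻¹, ⟨inv_anti₀ h hxt, ?_⟩, inv_inv x⟩
        rw [← hE x h.ne']
        exact (hd x).1 hx
    · refine (finite_singleton (0 : ℝ)).subset ?_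
      rintro x ⟨hxt, hx⟩
      rcases (hxt.trans ht).lt_or_eq with h | h
      · exact absurd (eq_bot_of_neg hnn hE h) ((hd x).1 hx)
      · exact h
  · refine ((infinite_nonzero_eigenvalues hGc hG hker hH).image
      (f := fun κ => κ⁻¹) inv_injective.injOn).mono ?_
    rintro _ ⟨κ, ⟨hκ, hne⟩, rfl⟩
    change finrank ℝ (E κ⁻¹) ≠ 0
    rwa [hd, hE _ (inv_ne_zero hκ), inv_inv]

/-- An eigenvalue list with a simple eigenvalue `0` and no negative ones starts at `0` and is
positive afterwards. -/
theorem eigenvalue_sequence_pos (hnn : ∀ u, 0 ≤ inner ℝ (G u) u)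
    (hE : ∀ x ≠ 0, E x = End.eigenspace (G : End ℝ H) x⁻¹) (hE0 : Module.rank ℝ (E 0) = 1)
    {lam : ℕ → ℝ} (hmono : Monotone lam)
    (hlam : ∀ x, Module.rank ℝ (E x) = Cardinal.mk {n : ℕ // lam n = x}) :
    lam 0 = 0 ∧ ∀ n, 1 ≤ n → 0 < lam n := by
  have hnonneg : ∀ n, 0 ≤ lam n := by
    intro n
    by_contra! hn
    have h1 := hlam (lam n)
    rw [eq_bot_of_neg hnn hE hn, rank_bot] at h1
    exact (Cardinal.mk_eq_zero_iff.1 h1.symm).false ⟨n, rfl⟩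
  have h1 := hlam 0
  rw [hE0] at h1
  obtain ⟨hsub, ⟨k⟩⟩ := Cardinal.eq_one_iff_unique.1 h1.symm
  have h0 : lam 0 = 0 := le_antisymm ((hmono (Nat.zero_le k.1)).trans_eq k.2) (hnonneg 0)
  refine ⟨h0, fun n hn => (hnonneg n).lt_of_ne' fun h => ?_⟩
  have := congrArg Subtype.val (Subsingleton.elim (α := {n // lam n = 0}) ⟨n, h⟩ ⟨0, h0⟩)
  simp only at this
  omega

/-- Orthonormal eigenvectors realizing a list of eigenvalues with multiplicity. -/
theorem exists_orthonormal_eigenvectors [CompleteSpace H] (hGc : IsCompactOperator G)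
    (hG : (G : H →ₗ[ℝ] H).IsSymmetric)
    (hE : ∀ x ≠ 0, E x = End.eigenspace (G : End ℝ H) x⁻¹) {lam : ℕ → ℝ}
    (hlam : ∀ x, Module.rank ℝ (E x) = Cardinal.mk {n : ℕ // lam n = x}) :
    ∃ e : {n // 0 < lam n} → H, Orthonormal ℝ e ∧
      ∀ n : {n // 0 < lam n}, G (e n) = (lam n)⁻¹ • e n := by
  have hb : ∀ x : {x : ℝ // 0 < x}, ∃ b : {n // lam n = x} → H, Orthonormal ℝ b ∧
      ∀ p, G (b p) = x.1⁻¹ • b p := by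
    rintro ⟨x, hx⟩
    have hfd := G.finite_dimensional_eigenspace hGc x⁻¹ (inv_ne_zero hx.ne')
    have h1 := hlam x
    rw [hE x hx.ne', ← finrank_eq_rank, ← Cardinal.mk_fin] at h1
    obtain ⟨φ⟩ := Cardinal.eq.1 h1.symm
    let B := stdOrthonormalBasis ℝ (End.eigenspace (G : End ℝ H) x⁻¹)
    refine ⟨fun p => (B (φ p) : H), ?_, fun p => End.mem_eigenspace_iff.1 (B (φ p)).2⟩
    exact (B.orthonormal.comp φ φ.injective).comp_linearIsometry
      (End.eigenspace (G : End ℝ H) x⁻¹).subtypeₗᵢ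
  let b := fun x => (hb x).choose
  have hbo : ∀ x, Orthonormal ℝ (b x) := fun x => (hb x).choose_spec.1
  have hbm : ∀ x p, G (b x p) = x.1⁻¹ • b x p := fun x =>
    (hb x).choose_spec.2
  have key : ∀ (x y : {x : ℝ // 0 < x}) (p : {n // lam n = x}) (q : {n // lam n = y}),
      p.1 ≠ q.1 → inner ℝ (b x p) (b y q) = 0 := by
    intro x y p q hpq
    by_cases hxy : x = y
    · subst hxy
      exact (hbo x).2 fun h => hpq (congrArg Subtype.val h)
    · have hne : x.1⁻¹ ≠ y.1⁻¹ := fun h => hxy (Subtype.ext (inv_injective h))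
      exact inner_eq_zero_of_eigenvalue_ne hG hne (hbm x p) (hbm y q)
  refine ⟨fun n => b ⟨lam n, n.2⟩ ⟨n, rfl⟩, ⟨fun n => (hbo _).1 _, fun m n hmn => ?_⟩,
    fun n => hbm _ _⟩
  exact key _ _ _ _ fun h => hmn (Subtype.ext h)

/-- Quadratic growth of the reciprocals of the eigenvalues of an operator with quadratic decay. -/
theorem eigenvalue_sequence_lower_bound [CompleteSpace H] (hM : QuadraticDecay G M)
    (hM0 : 0 < M) (hGc : IsCompactOperator G) (hG : (G : H →ₗ[ℝ] H).IsSymmetric)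
    (hnn : ∀ u, 0 ≤ inner ℝ (G u) u)
    (hE : ∀ x ≠ 0, E x = End.eigenspace (G : End ℝ H) x⁻¹) (hE0 : Module.rank ℝ (E 0) = 1)
    {lam : ℕ → ℝ} (hmono : Monotone lam)
    (hlam : ∀ x, Module.rank ℝ (E x) = Cardinal.mk {n : ℕ // lam n = x}) :
    ∃ C : ℝ, 0 < C ∧ ∀ n : ℕ, 1 ≤ n → C * (n : ℝ) ^ 2 ≤ lam n := by
  obtain ⟨-, hpos⟩ := eigenvalue_sequence_pos hnn hE hE0 hmono hlam
  obtain ⟨e, heo, hem⟩ := exists_orthonormal_eigenvectors hGc hG hE hlam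
  -- the eigenvectors with indices `1, …, n + 1` span more than the `n` dimensions available
  have hlow : ∀ n : ℕ, 1 ≤ n → (n / M) ^ 2 ≤ lam (n + 1) := by
    intro n hn
    by_contra! hlt
    have hp := hpos (n + 1) (by omega)
    have hn0 : (0 : ℝ) < n := by exact_mod_cast hn
    have ht : (M / n) ^ 2 < (lam (n + 1))⁻¹ := by
      rw [← inv_div, inv_pow]
      exact inv_strictAnti₀ hp hlt
    obtain ⟨hfd, hle⟩ := hM.finrank_upperEigensum hG hn ht
    let w : Fin (n + 1) → upperEigensum G (lam (n + 1))⁻¹ := fun i =>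
      ⟨e ⟨i + 1, hpos _ (Nat.le_add_left 1 _)⟩, mem_upperEigensum
        (inv_anti₀ (hpos _ (Nat.le_add_left 1 _)) (hmono (Nat.succ_le_of_lt (by simp [i.2]))))
        (hem _)⟩
    have hw : LinearIndependent ℝ w := by
      refine LinearIndependent.of_comp (upperEigensum G _).subtype ?_
      refine heo.linearIndependent.comp
        (fun i : Fin (n + 1) => (⟨i + 1, hpos _ (Nat.le_add_left 1 _)⟩ : {n // 0 < lam n})) ?_
      intro i j hij
      simpa [Fin.ext_iff] using hij
    have := hw.fintype_card_le_finrank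
    rw [Fintype.card_fin] at this
    omega
  -- `k + 1 ≤ 2 * k` for `k ≥ 1` costs the factor `4`; the first eigenvalue is treated apart
  refine ⟨min (lam 1) (1 / (4 * M ^ 2)), lt_min (hpos 1 le_rfl) (by positivity), ?_⟩
  intro n hn
  obtain ⟨k, rfl⟩ := Nat.exists_eq_add_of_le' hn
  rcases Nat.eq_zero_or_pos k with rfl | hk
  · simp
  · refine le_trans ?_ (hlow k hk)
    have hk' : (1 : ℝ) ≤ k := by exact_mod_cast hk
    calc min (lam 1) (1 / (4 * M ^ 2)) * ((k + 1 : ℕ) : ℝ) ^ 2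
        ≤ 1 / (4 * M ^ 2) * (2 * k) ^ 2 := by
          push_cast
          gcongr
          · exact min_le_right _ _
          · linarith
      _ = (k / M) ^ 2 := by field_simp; norm_num

end Sequence

end Hilbert

/-! ### Integral operators with indicator kernels -/

section Kernel

/-- The Cauchy–Schwarz inequality against the constant function `1`. -/
theorem sq_integral_le {μ : Measure ℝ} [IsFiniteMeasure μ] {u : ℝ → ℝ} (hu : MemLp u 2 μ) :
    (∫ s, u s ∂μ) ^ 2 ≤ μ.real univ * ∫ s, u s ^ 2 ∂μ := by
  have h := real_inner_mul_inner_self_le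
    (indicatorConstLp 2 MeasurableSet.univ (measure_ne_top μ univ) (1 : ℝ)) (hu.toLp u)
  rw [L2.real_inner_indicatorConstLp_one_indicatorConstLp_one, L2.inner_indicatorConstLp_one,
    Measure.restrict_univ, integral_congr_ae hu.coeFn_toLp, L2.inner_def, inter_self,
    ← pow_two] at h
  refine h.trans_eq ?_
  congr 1
  refine integral_congr_ae ?_
  filter_upwards [hu.coeFn_toLp] with s hs
  simp [hs, pow_two]

theorem norm_sq_L2 {μ : Measure ℝ} (u : Lp ℝ 2 μ) : ‖u‖ ^ 2 = ∫ s, u s ^ 2 ∂μ := by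
  rw [← real_inner_self_eq_norm_sq, L2.inner_def]
  simp [pow_two]

theorem L2_integrable {μ : Measure ℝ} [IsFiniteMeasure μ] (u : Lp ℝ 2 μ) : Integrable u μ :=
  (Lp.memLp u).integrable (by norm_num)

theorem abs_setIntegral_le {μ : Measure ℝ} [IsFiniteMeasure μ] (u : Lp ℝ 2 μ) {t : Set ℝ} :
    |∫ s in t, u s ∂μ| ≤ √(μ.real univ) * ‖u‖ := by
  have h1 : |∫ s in t, u s ∂μ| ≤ ∫ s, |u s| ∂μ :=
    (norm_integral_le_integral_norm _).trans (setIntegral_le_integral (L2_integrable u).norm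
      (Eventually.of_forall fun _ => norm_nonneg _))
  refine h1.trans (abs_le_of_sq_le_sq' ?_ (by positivity)).2
  have := sq_integral_le (Lp.memLp u).abs
  rw [mul_pow, Real.sq_sqrt measureReal_nonneg, norm_sq_L2]
  simpa using this

variable (R : Set (ℝ × ℝ)) (μ ν : Measure ℝ)

/-- The integral operator with kernel the indicator of `R`, on functions. -/
def kernelFun (u : ℝ → ℝ) (y : ℝ) : ℝ := ∫ s in {s | (y, s) ∈ R}, u s ∂μ

variable {R}

theorem kernelFun_eq (hR : MeasurableSet R) (u : ℝ → ℝ) (y : ℝ) :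
    kernelFun R μ u y = ∫ s, R.indicator (fun p => u p.2) (y, s) ∂μ := by
  rw [kernelFun, ← integral_indicator (s := {s | (y, s) ∈ R}) (measurable_prodMk_left hR)]
  rfl

variable [IsFiniteMeasure μ] [IsFiniteMeasure ν]

theorem stronglyMeasurable_kernelFun (hR : MeasurableSet R) (u : Lp ℝ 2 μ) :
    StronglyMeasurable (kernelFun R μ u) := by
  rw [funext (kernelFun_eq μ hR u)]
  apply StronglyMeasurable.integral_prod_right'
  exact ((Lp.stronglyMeasurable u).comp_measurable measurable_snd).indicator hR

theorem memLp_kernelFun (hR : MeasurableSet R) (u : Lp ℝ 2 μ) :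
    MemLp (kernelFun R μ u) 2 ν :=
  MemLp.of_bound (stronglyMeasurable_kernelFun μ hR u).aestronglyMeasurable
    (√(μ.real univ) * ‖u‖) (Eventually.of_forall fun _ => abs_setIntegral_le u)

/-- The integral operator `L²(μ) → L²(ν)` with kernel the indicator of `R`. -/
def kernelOp (hR : MeasurableSet R) : Lp ℝ 2 μ →L[ℝ] Lp ℝ 2 ν :=
  LinearMap.mkContinuous
    { toFun := fun u => (memLp_kernelFun μ ν hR u).toLp _
      map_add' := fun u v => by
        rw [← MemLp.toLp_add]
        refine MemLp.toLp_congr _ _ (Eventually.of_forall fun y => ?_)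
        rw [Pi.add_apply, kernelFun, kernelFun, kernelFun,
          ← integral_add (L2_integrable u).integrableOn (L2_integrable v).integrableOn]
        exact integral_congr_ae (ae_restrict_of_ae (Lp.coeFn_add u v))
      map_smul' := fun c u => by
        rw [RingHom.id_apply, ← MemLp.toLp_const_smul]
        refine MemLp.toLp_congr _ _ (Eventually.of_forall fun y => ?_)
        rw [Pi.smul_apply, kernelFun, kernelFun, ← integral_smul]
        exact integral_congr_ae (ae_restrict_of_ae (Lp.coeFn_smul c u)) }
    ((ν univ).toReal ^ ((2 : ENNReal).toReal)⁻¹ * √(μ.real univ)) fun u => by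
      rw [mul_assoc]
      refine Lp.norm_le_of_ae_bound (by positivity) ?_
      filter_upwards [(memLp_kernelFun μ ν hR u).coeFn_toLp] with y hy
      change ‖((memLp_kernelFun μ ν hR u).toLp _) y‖ ≤ _
      rw [hy]
      exact abs_setIntegral_le u

theorem coeFn_kernelOp (hR : MeasurableSet R) (u : Lp ℝ 2 μ) :
    kernelOp μ ν hR u =ᵐ[ν] kernelFun R μ u :=
  (memLp_kernelFun μ ν hR u).coeFn_toLp

/-- By Fubini, the adjoint is the integral operator with the transposed kernel. -/
theorem inner_kernelOp (hR : MeasurableSet R) (u : Lp ℝ 2 μ) (g : Lp ℝ 2 ν) :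
    inner ℝ (kernelOp μ ν hR u) g =
      inner ℝ u (kernelOp ν μ (R := Prod.swap ⁻¹' R) (measurable_swap hR) g) := by
  have h1 : inner ℝ (kernelOp μ ν hR u) g =
      ∫ y, ∫ s, R.indicator (fun p => u p.2 * g p.1) (y, s) ∂μ ∂ν := by
    rw [L2.inner_def]
    refine integral_congr_ae ?_
    filter_upwards [coeFn_kernelOp μ ν hR u] with y hy
    change g y * (kernelOp μ ν hR u) y = _
    rw [hy, kernelFun_eq μ hR]
    rw [← integral_const_mul]
    congr 1
    funext s
    by_cases h : (y, s) ∈ R <;> simp [h, mul_comm]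
  have h2 : inner ℝ u (kernelOp ν μ (R := Prod.swap ⁻¹' R) (measurable_swap hR) g) =
      ∫ s, ∫ y, R.indicator (fun p => u p.2 * g p.1) (y, s) ∂ν ∂μ := by
    rw [L2.inner_def]
    refine integral_congr_ae ?_
    filter_upwards [coeFn_kernelOp ν μ (R := Prod.swap ⁻¹' R) (measurable_swap hR) g] with s hs
    change (kernelOp ν μ (R := Prod.swap ⁻¹' R) (measurable_swap hR) g) s * u s = _
    rw [hs, kernelFun_eq ν (measurable_swap hR)]
    rw [mul_comm, ← integral_const_mul]
    congr 1
    funext y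
    by_cases h : (y, s) ∈ R <;> simp [h]
  rw [h1, h2]
  refine integral_integral_swap ?_
  have h3 : Integrable (fun p : ℝ × ℝ => g p.1 * u p.2) (ν.prod μ) :=
    (L2_integrable g).mul_prod (L2_integrable u)
  refine (h3.indicator hR).congr (Eventually.of_forall fun p => ?_)
  by_cases h : p ∈ R <;> simp [Function.uncurry, h, mul_comm]

end Kernel

/-! ### The Volterra operator and its approximation numbers -/

section Volterra

variable (μ ν : Measure ℝ)

theorem measurableSet_snd_lt_fst : MeasurableSet {p : ℝ × ℝ | p.2 < p.1} :=
  measurableSet_lt measurable_snd measurable_fst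

/-- A monotone function whose increments control both `μ` and `ν`. Open and closed half-lines are
both used, so that an atom at `x` is seen by `levelFun` immediately before and after `x`. -/
def levelFun (x : ℝ) : ℝ :=
  μ.real (Iio x) + μ.real (Iic x) + (ν.real (Iio x) + ν.real (Iic x))

/-- A strict upper bound of `levelFun`. -/
def levelBound : ℝ := 2 * μ.real univ + 2 * ν.real univ + 1

theorem levelBound_pos : 0 < levelBound μ ν := by unfold levelBound; positivity

theorem levelFun_nonneg (x : ℝ) : 0 ≤ levelFun μ ν x := by unfold levelFun; positivity

/-- The index, among `n` of them, of the level set of `levelFun` containing `x`. -/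
def levelIndex (n : ℕ) (x : ℝ) : ℕ := ⌊n * levelFun μ ν x / levelBound μ ν⌋₊

theorem levelFun_sub_le {n : ℕ} (hn : 1 ≤ n) {x y : ℝ}
    (h : levelIndex μ ν n x = levelIndex μ ν n y) :
    levelFun μ ν y - levelFun μ ν x ≤ levelBound μ ν / n := by
  have h0 := levelBound_pos μ ν
  have hn' : (0 : ℝ) < n := by exact_mod_cast hn
  have h1 := Nat.lt_floor_add_one (n * levelFun μ ν y / levelBound μ ν)
  have h2 := Nat.floor_le (div_nonneg (mul_nonneg hn'.le (levelFun_nonneg μ ν x)) h0.le)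
  unfold levelIndex at h
  rw [← h] at h1
  have h3 : n * levelFun μ ν y / levelBound μ ν < n * levelFun μ ν x / levelBound μ ν + 1 := by
    linarith
  rw [div_add_one h0.ne', div_lt_div_iff_of_pos_right h0] at h3
  rw [le_div_iff₀ hn']
  linarith

variable [IsFiniteMeasure μ] [IsFiniteMeasure ν]

/-- The Volterra operator `L²(μ) → L²(ν)` sending `u` to `y ↦ ∫_{(-∞, y)} u dμ`. -/
def volterra : Lp ℝ 2 μ →L[ℝ] Lp ℝ 2 ν := kernelOp μ ν measurableSet_snd_lt_fst

theorem coeFn_volterra (u : Lp ℝ 2 μ) :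
    volterra μ ν u =ᵐ[ν] fun y => ∫ s in Iio y, u s ∂μ :=
  coeFn_kernelOp μ ν measurableSet_snd_lt_fst u

theorem coeFn_adjoint_volterra (g : Lp ℝ 2 ν) :
    (volterra μ ν).adjoint g =ᵐ[μ] fun x => ∫ y in Ioi x, g y ∂ν := by
  have : (volterra μ ν).adjoint g = kernelOp ν μ (measurable_swap measurableSet_snd_lt_fst) g := by
    refine ext_inner_left ℝ fun u => ?_
    rw [ContinuousLinearMap.adjoint_inner_right]
    exact inner_kernelOp μ ν measurableSet_snd_lt_fst u g
  rw [this]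
  exact coeFn_kernelOp ν μ (measurable_swap measurableSet_snd_lt_fst) g

theorem levelFun_lt (x : ℝ) : levelFun μ ν x < levelBound μ ν := by
  have h1 := measureReal_mono (μ := μ) (subset_univ (Iio x))
  have h2 := measureReal_mono (μ := μ) (subset_univ (Iic x))
  have h3 := measureReal_mono (μ := ν) (subset_univ (Iio x))
  have h4 := measureReal_mono (μ := ν) (subset_univ (Iic x))
  unfold levelFun levelBound
  linarith

theorem levelFun_mono : Monotone (levelFun μ ν) := by
  intro x y h
  unfold levelFun
  gcongr <;> exact measure_ne_top _ _

theorem measureReal_Icc_le {x y : ℝ} (h : x < y) :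
    μ.real (Icc x y) ≤ levelFun μ ν y - levelFun μ ν x ∧
      ν.real (Icc x y) ≤ levelFun μ ν y - levelFun μ ν x := by
  have key : ∀ (κ : Measure ℝ) [IsFiniteMeasure κ],
      κ.real (Icc x y) = κ.real (Iic y) - κ.real (Iio x) ∧
        κ.real (Iic x) ≤ κ.real (Iio y) ∧ κ.real (Icc x y) ≤
          κ.real (Iio y) + κ.real (Iic y) - κ.real (Iio x) - κ.real (Iic x) := by
    intro κ _
    have h1 : κ.real (Icc x y) = κ.real (Iic y) - κ.real (Iio x) := by
      have : Icc x y = Iic y \ Iio x := by ext; simp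
      rw [this, measureReal_sdiff (Iio_subset_Iic h.le) measurableSet_Iio]
    have h2 : κ.real (Iic x) ≤ κ.real (Iio y) := measureReal_mono (Iic_subset_Iio.2 h)
    exact ⟨h1, h2, by linarith⟩
  have hμ := key μ
  have hν := key ν
  have h0 : 0 ≤ μ.real (Icc x y) := measureReal_nonneg
  have h0' : 0 ≤ ν.real (Icc x y) := measureReal_nonneg
  unfold levelFun
  constructor <;> linarith [hμ.2.2, hν.2.2]

theorem levelIndex_mono (n : ℕ) : Monotone (levelIndex μ ν n) := by
  intro x y h
  have := levelBound_pos μ ν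
  unfold levelIndex
  gcongr
  exact levelFun_mono μ ν h

theorem levelIndex_lt {n : ℕ} (hn : 1 ≤ n) (x : ℝ) : levelIndex μ ν n x < n := by
  have h0 := levelBound_pos μ ν
  have hn' : (0 : ℝ) < n := by exact_mod_cast hn
  rw [levelIndex, Nat.floor_lt' (by omega), div_lt_iff₀ h0]
  exact mul_lt_mul_of_pos_left (levelFun_lt μ ν x) hn'

/-- The `k`-th of the `n` level sets of `levelFun`. -/
def levelSet (n k : ℕ) : Set ℝ := levelIndex μ ν n ⁻¹' {k}

theorem measurableSet_levelSet (n k : ℕ) : MeasurableSet (levelSet μ ν n k) :=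
  (levelIndex_mono μ ν n).measurable (measurableSet_singleton k)

/-- A level set with at least two points has small measure. -/
theorem measureReal_levelSet_le {n k : ℕ} (hn : 1 ≤ n) {x y : ℝ} (hxy : x < y)
    (hx : x ∈ levelSet μ ν n k) (hy : y ∈ levelSet μ ν n k) :
    μ.real (levelSet μ ν n k) ≤ levelBound μ ν / n ∧
      ν.real (levelSet μ ν n k) ≤ levelBound μ ν / n := by
  have h0 : 0 ≤ levelBound μ ν / n := div_nonneg (levelBound_pos μ ν).le (Nat.cast_nonneg n)
  have key : ∀ (κ : Measure ℝ) [IsFiniteMeasure κ],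
      (∀ a b, a < b → κ.real (Icc a b) ≤ levelFun μ ν b - levelFun μ ν a) →
        κ.real (levelSet μ ν n k) ≤ levelBound μ ν / n := by
    intro κ _ hκ
    rw [measureReal_def, (measurableSet_levelSet μ ν n k).measure_eq_iSup_isCompact_of_ne_top
      (measure_ne_top _ _)]
    refine ENNReal.toReal_le_of_le_ofReal h0
      (iSup_le fun K => iSup_le fun hK => iSup_le fun hc => ?_)
    rcases K.eq_empty_or_nonempty with rfl | hne
    · simp
    have ha := hK (hc.sInf_mem hne)
    have hb := hK (hc.sSup_mem hne)
    -- including `x` and `y` makes the interval nondegenerate, as `measureReal_Icc_le` requires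
    set a := min (sInf K) x with ha_def
    set b := max (sSup K) y with hb_def
    have ha' : a ∈ levelSet μ ν n k := by
      rcases min_choice (sInf K) x with h | h <;> rw [ha_def, h] <;> assumption
    have hb' : b ∈ levelSet μ ν n k := by
      rcases max_choice (sSup K) y with h | h <;> rw [hb_def, h] <;> assumption
    have hab : a < b := (min_le_right _ _).trans_lt (hxy.trans_le (le_max_right _ _))
    have hsub : K ⊆ Icc a b := fun z hz =>
      ⟨(min_le_left _ _).trans (csInf_le hc.bddBelow hz),
        (le_csSup hc.bddAbove hz).trans (le_max_left _ _)⟩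
    have h1 : κ.real (Icc a b) ≤ levelBound μ ν / n :=
      (hκ a b hab).trans (levelFun_sub_le μ ν hn (Eq.trans ha' (Eq.symm hb')))
    calc κ K ≤ κ (Icc a b) := measure_mono hsub
      _ = ENNReal.ofReal (κ.real (Icc a b)) := (ofReal_measureReal).symm
      _ ≤ _ := ENNReal.ofReal_le_ofReal h1
  exact ⟨key μ fun a b h => (measureReal_Icc_le μ ν h).1,
    key ν fun a b h => (measureReal_Icc_le μ ν h).2⟩

theorem setIntegral_preimage_levelIndex {κ : Measure ℝ} {φ : ℝ → ℝ} (hφ : Integrable φ κ)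
    (n : ℕ) (s : Finset ℕ) :
    ∫ x in levelIndex μ ν n ⁻¹' s, φ x ∂κ = ∑ k ∈ s, ∫ x in levelSet μ ν n k, φ x ∂κ := by
  have : levelIndex μ ν n ⁻¹' s = ⋃ k ∈ s, levelSet μ ν n k := by
    ext x; simp [levelSet]
  rw [this, integral_biUnion_finset s (fun k _ => measurableSet_levelSet μ ν n k) ?_
    fun k _ => hφ.integrableOn]
  intro i _ j _ hij
  exact Disjoint.preimage _ (by simpa using hij)

theorem integral_eq_sum_levelSet {κ : Measure ℝ} {φ : ℝ → ℝ} (hφ : Integrable φ κ)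
    {n : ℕ} (hn : 1 ≤ n) :
    ∫ x, φ x ∂κ = ∑ k ∈ Finset.range n, ∫ x in levelSet μ ν n k, φ x ∂κ := by
  rw [← setIntegral_preimage_levelIndex μ ν hφ]
  have : levelIndex μ ν n ⁻¹' (Finset.range n : Set ℕ) = univ := by
    ext x; simp [levelIndex_lt μ ν hn x]
  rw [this, Measure.restrict_univ]

/-- If `u` has mean zero on every level set, then its primitive at a point only depends on the
values of `u` on the level set of that point. -/
theorem setIntegral_Iio_eq {u : ℝ → ℝ} (hu : Integrable u μ) {n k : ℕ}
    (h0 : ∀ j, ∫ x in levelSet μ ν n j, u x ∂μ = 0) {y : ℝ} (hy : y ∈ levelSet μ ν n k) :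
    ∫ s in Iio y, u s ∂μ = ∫ s in levelSet μ ν n k ∩ Iio y, u s ∂μ := by
  have hy' : levelIndex μ ν n y = k := hy
  have hset : Iio y = levelIndex μ ν n ⁻¹' (Finset.range k : Set ℕ) ∪
      levelSet μ ν n k ∩ Iio y := by
    ext s
    simp only [mem_Iio, Finset.coe_range, mem_union, mem_preimage, mem_inter_iff, levelSet,
      mem_singleton_iff]
    constructor
    · intro hs
      rcases (levelIndex_mono μ ν n hs.le).lt_or_eq with h | h
      · exact Or.inl (h.trans_eq hy')
      · exact Or.inr ⟨h.trans hy', hs⟩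
    · rintro (h | h)
      · exact (levelIndex_mono μ ν n).reflect_lt (h.trans_eq hy'.symm)
      · exact h.2
  conv_lhs => rw [hset]
  rw [setIntegral_union ?_ ((measurableSet_levelSet μ ν n k).inter measurableSet_Iio)
    hu.integrableOn hu.integrableOn, setIntegral_preimage_levelIndex μ ν hu,
    Finset.sum_eq_zero fun j _ => h0 j, zero_add]
  rw [disjoint_left]
  rintro s hs ⟨hs', -⟩
  have h1 : levelIndex μ ν n s = k := hs'
  have h2 : levelIndex μ ν n s < k := by simpa using hs
  omega

/-- On functions with mean zero on each of the `n` level sets, the Volterra operator has norm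
`O(1/n)`: on a level set with two points Cauchy–Schwarz gives a factor `M / n` from each of the two
measures, and on a one-point level set the primitive vanishes. -/
theorem norm_volterra_le {n : ℕ} (hn : 1 ≤ n) (u : Lp ℝ 2 μ)
    (h0 : ∀ j, ∫ x in levelSet μ ν n j, u x ∂μ = 0) :
    ‖volterra μ ν u‖ ≤ levelBound μ ν / n * ‖u‖ := by
  have hM : 0 ≤ levelBound μ ν / n := div_nonneg (levelBound_pos μ ν).le (Nat.cast_nonneg n)
  refine (abs_le_of_sq_le_sq' ?_ (by positivity)).2
  set A : ℝ → ℝ := fun y => ∫ s in Iio y, u s ∂μ with hA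
  have hAi : Integrable (fun y => A y ^ 2) ν :=
    (memLp_kernelFun μ ν measurableSet_snd_lt_fst u).integrable_sq
  have hui : Integrable (fun y => u y ^ 2) μ := (Lp.memLp u).integrable_sq
  have h1 : ∫ y, (volterra μ ν u) y ^ 2 ∂ν = ∫ y, A y ^ 2 ∂ν := by
    refine integral_congr_ae ?_
    filter_upwards [coeFn_volterra μ ν u] with y hy
    rw [hy]
  rw [mul_pow, norm_sq_L2, norm_sq_L2, h1, integral_eq_sum_levelSet μ ν hAi hn,
    integral_eq_sum_levelSet μ ν hui hn, Finset.mul_sum]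
  refine Finset.sum_le_sum fun k _ => ?_
  set J := levelSet μ ν n k with hJ
  have hJm : MeasurableSet J := measurableSet_levelSet μ ν n k
  have hJ0 : 0 ≤ ∫ x in J, u x ^ 2 ∂μ := integral_nonneg fun _ => sq_nonneg _
  have hAy : ∀ y ∈ J, A y = ∫ s in J ∩ Iio y, u s ∂μ := fun y hy =>
    setIntegral_Iio_eq μ ν (L2_integrable u) h0 hy
  by_cases hsub : ∃ x ∈ J, ∃ y ∈ J, x < y
  · obtain ⟨x, hx, y, hy, hxy⟩ := hsub
    obtain ⟨hμ, hν⟩ := measureReal_levelSet_le μ ν hn hxy hx hy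
    have hb : ∀ y ∈ J, A y ^ 2 ≤ levelBound μ ν / n * ∫ x in J, u x ^ 2 ∂μ := by
      intro y hy
      rw [hAy y hy]
      refine (sq_integral_le ((Lp.memLp u).restrict _)).trans ?_
      rw [measureReal_restrict_apply_univ]
      exact mul_le_mul ((measureReal_mono inter_subset_left).trans hμ)
        (setIntegral_mono_set hui.integrableOn (Eventually.of_forall fun _ => sq_nonneg _)
          inter_subset_left.eventuallyLE) (integral_nonneg fun _ => sq_nonneg _) hM
    calc ∫ y in J, A y ^ 2 ∂ν
        ≤ ∫ _ in J, levelBound μ ν / n * ∫ x in J, u x ^ 2 ∂μ ∂ν :=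
          setIntegral_mono_on hAi.integrableOn (integrableOn_const (measure_ne_top _ _)) hJm hb
      _ = ν.real J * (levelBound μ ν / n * ∫ x in J, u x ^ 2 ∂μ) := by
          rw [setIntegral_const, smul_eq_mul]
      _ ≤ levelBound μ ν / n * (levelBound μ ν / n * ∫ x in J, u x ^ 2 ∂μ) := by gcongr
      _ = _ := by ring
  · have hz : ∀ y ∈ J, A y ^ 2 = 0 := by
      intro y hy
      have : J ∩ Iio y = ∅ := by
        rw [eq_empty_iff_forall_notMem]
        exact fun z hz => hsub ⟨z, hz.1, y, hy, hz.2⟩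
      rw [hAy y hy, this, setIntegral_empty, zero_pow two_ne_zero]
    rw [setIntegral_congr_fun hJm hz, integral_zero]
    positivity

/-- The constant function `1` in `L²(μ)`. -/
def oneLp : Lp ℝ 2 μ := indicatorConstLp 2 MeasurableSet.univ (measure_ne_top μ univ) (1 : ℝ)

theorem inner_oneLp (u : Lp ℝ 2 μ) : inner ℝ (oneLp μ) u = ∫ s, u s ∂μ := by
  rw [oneLp, L2.inner_indicatorConstLp_one, Measure.restrict_univ]

theorem coeFn_oneLp : oneLp μ =ᵐ[μ] fun _ => 1 := by
  filter_upwards [indicatorConstLp_coeFn (p := 2) (hs := MeasurableSet.univ)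
    (hμs := measure_ne_top μ univ) (c := (1 : ℝ))] with x hx
  rw [oneLp, hx]
  simp

/-- The Volterra operator is `O(1/n)` on a subspace of codimension at most `n`, which moreover
consists of functions of mean zero: the complement of the indicators of the level sets. -/
theorem exists_finrank_le_norm_volterra_le {n : ℕ} (hn : 1 ≤ n) :
    ∃ S : Submodule ℝ (Lp ℝ 2 μ), FiniteDimensional ℝ S ∧ Module.finrank ℝ S ≤ n ∧
      ∀ u ∈ Sᗮ, inner ℝ (oneLp μ) u = 0 ∧ ‖volterra μ ν u‖ ≤ levelBound μ ν / n * ‖u‖ := by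
  let w : Fin n → Lp ℝ 2 μ := fun k => indicatorConstLp 2 (measurableSet_levelSet μ ν n k)
    (measure_ne_top _ _) (1 : ℝ)
  refine ⟨Submodule.span ℝ (range w), FiniteDimensional.span_of_finite ℝ (finite_range w), ?_, ?_⟩
  · exact (finrank_range_le_card w).trans_eq (Fintype.card_fin n)
  · intro u hu
    have h0 : ∀ j, ∫ x in levelSet μ ν n j, u x ∂μ = 0 := by
      intro j
      by_cases hj : j < n
      · have := (Submodule.mem_orthogonal _ _).1 hu (w ⟨j, hj⟩)
          (Submodule.subset_span (mem_range_self _))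
        rwa [L2.inner_indicatorConstLp_one] at this
      · have : levelSet μ ν n j = ∅ := by
          rw [eq_empty_iff_forall_notMem]
          intro x hx
          have h1 : levelIndex μ ν n x = j := hx
          exact hj (h1 ▸ levelIndex_lt μ ν hn x)
        rw [this, setIntegral_empty]
    refine ⟨?_, norm_volterra_le μ ν hn u h0⟩
    rw [inner_oneLp, integral_eq_sum_levelSet μ ν (L2_integrable u) hn]
    exact Finset.sum_eq_zero fun j _ => h0 j

/-- The Volterra operator is a norm limit of operators of finite rank, namely its compositions with
the projections onto the spans of the indicators of the level sets. -/
theorem isCompactOperator_volterra : IsCompactOperator (volterra μ ν) := by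
  choose S hfd _ hS using fun n : ℕ =>
    exists_finrank_le_norm_volterra_le μ ν (Nat.succ_le_succ (Nat.zero_le n))
  let T : ℕ → Lp ℝ 2 μ →L[ℝ] Lp ℝ 2 ν := fun n =>
    ((volterra μ ν).comp (S n).subtypeL).comp (S n).orthogonalProjectionOnto
  refine isCompactOperator_of_tendsto (F := T) (l := atTop) ?_ ?_
  · rw [tendsto_iff_norm_sub_tendsto_zero]
    refine squeeze_zero (fun _ => norm_nonneg _) (fun n => ?_)
      ((tendsto_const_div_atTop_nhds_zero_nat (levelBound μ ν)).comp (tendsto_add_atTop_nat 1))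
    rw [norm_sub_rev]
    refine ContinuousLinearMap.opNorm_le_bound _ (div_nonneg (levelBound_pos μ ν).le
      (Nat.cast_nonneg _)) fun u => ?_
    have h1 : (volterra μ ν - T n) u = volterra μ ν (u - (S n).starProjection u) := by
      rw [map_sub]; rfl
    rw [h1]
    have h2 := (S n).sub_starProjection_mem_orthogonal u
    refine ((hS n _ h2).2).trans ?_
    refine mul_le_mul_of_nonneg_left ?_ (div_nonneg (levelBound_pos μ ν).le
      (Nat.cast_nonneg _))
    rw [← Submodule.starProjection_orthogonal_val]
    exact Submodule.norm_starProjection_apply_le _ _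
  · refine Eventually.of_forall fun n => ?_
    have : ProperSpace (S n) := FiniteDimensional.proper ℝ (S n)
    exact (isCompactOperator_of_locallyCompactSpace_rng
      ((volterra μ ν).comp (S n).subtypeL)).comp_clm _

end Volterra

/-! ### The Green operator -/

section Green

variable (μ ν : Measure ℝ) [IsFiniteMeasure μ] [IsFiniteMeasure ν]

/-- The orthogonal projection of `L²(μ)` onto the functions of mean zero. -/
def meanProj : Lp ℝ 2 μ →L[ℝ] Lp ℝ 2 μ := (Submodule.span ℝ {oneLp μ})ᗮ.starProjection

theorem exists_meanProj_eq (u : Lp ℝ 2 μ) : ∃ c : ℝ, meanProj μ u = u - c • oneLp μ := by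
  obtain ⟨c, hc⟩ := Submodule.mem_span_singleton.1
    ((Submodule.span ℝ {oneLp μ}).starProjection_apply_mem u)
  exact ⟨c, by rw [hc, meanProj, Submodule.starProjection_orthogonal_val]⟩

theorem inner_oneLp_meanProj (u : Lp ℝ 2 μ) : inner ℝ (oneLp μ) (meanProj μ u) = 0 :=
  Submodule.mem_orthogonal_singleton_iff_inner_right.1 (Submodule.starProjection_apply_mem _ u)

variable {μ} in
theorem meanProj_eq_self {u : Lp ℝ 2 μ} (hu : inner ℝ (oneLp μ) u = 0) : meanProj μ u = u :=
  Submodule.starProjection_eq_self_iff.2 (Submodule.mem_orthogonal_singleton_iff_inner_right.2 hu)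

theorem meanProj_oneLp : meanProj μ (oneLp μ) = 0 := by
  rw [meanProj, Submodule.starProjection_orthogonal_val,
    Submodule.starProjection_eq_self_iff.2 (Submodule.mem_span_singleton_self _), sub_self]

theorem inner_meanProj (u v : Lp ℝ 2 μ) :
    inner ℝ (meanProj μ u) v = inner ℝ u (meanProj μ v) :=
  Submodule.inner_starProjection_left_eq_right _ u v

theorem inner_meanProj_meanProj (u v : Lp ℝ 2 μ) :
    inner ℝ (meanProj μ u) v = inner ℝ (meanProj μ u) (meanProj μ v) := by
  rw [← inner_meanProj, meanProj_eq_self (inner_oneLp_meanProj μ u)]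

theorem norm_meanProj_le (u : Lp ℝ 2 μ) : ‖meanProj μ u‖ ≤ ‖u‖ :=
  Submodule.norm_starProjection_apply_le _ u

/-- The Green operator of the Laplacian: the inverse of `-Δ` on functions of mean zero, extended
by `0` to the constants. -/
def greenOp : Lp ℝ 2 μ →L[ℝ] Lp ℝ 2 μ :=
  meanProj μ ∘L (volterra μ ν).adjoint ∘L meanProj ν ∘L volterra μ ν ∘L meanProj μ

theorem greenOp_apply (u : Lp ℝ 2 μ) : greenOp μ ν u =
    meanProj μ ((volterra μ ν).adjoint (meanProj ν (volterra μ ν (meanProj μ u)))) := rfl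

theorem inner_greenOp (u v : Lp ℝ 2 μ) : inner ℝ (greenOp μ ν u) v =
    inner ℝ (meanProj ν (volterra μ ν (meanProj μ u)))
      (meanProj ν (volterra μ ν (meanProj μ v))) := by
  rw [greenOp_apply, inner_meanProj, ContinuousLinearMap.adjoint_inner_left,
    inner_meanProj_meanProj]

theorem greenOp_isSymmetric : (greenOp μ ν : Lp ℝ 2 μ →ₗ[ℝ] Lp ℝ 2 μ).IsSymmetric := by
  intro u v
  change inner ℝ (greenOp μ ν u) v = inner ℝ u (greenOp μ ν v)
  rw [inner_greenOp, real_inner_comm, ← inner_greenOp, real_inner_comm]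

theorem inner_greenOp_self_nonneg (u : Lp ℝ 2 μ) : 0 ≤ inner ℝ (greenOp μ ν u) u := by
  rw [inner_greenOp]
  exact real_inner_self_nonneg

theorem greenOp_isCompactOperator : IsCompactOperator (greenOp μ ν) :=
  ((isCompactOperator_volterra μ ν).comp_clm (meanProj μ)).clm_comp
    (meanProj μ ∘L (volterra μ ν).adjoint ∘L meanProj ν)

theorem greenOp_quadraticDecay : QuadraticDecay (greenOp μ ν) (levelBound μ ν) := by
  intro n hn
  obtain ⟨S, hfd, hle, hS⟩ := exists_finrank_le_norm_volterra_le μ ν hn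
  refine ⟨S, hfd, hle, fun u hu => ?_⟩
  obtain ⟨h1, h2⟩ := hS u hu
  rw [inner_greenOp, real_inner_self_eq_norm_sq, meanProj_eq_self h1, ← mul_pow]
  gcongr
  exact (norm_meanProj_le ν _).trans h2

theorem not_finiteDimensional_L2 (h : ∀ p q : ℝ, 0 ≤ p → p < q → q ≤ 1 → 0 < μ (Ioo p q)) :
    ¬ FiniteDimensional ℝ (Lp ℝ 2 μ) := by
  intro hfd
  -- the indicators of the intervals `(1 / (n + 2), 1 / (n + 1))` are orthogonal and nonzero
  let a : ℕ → ℝ := fun n => 1 / ((n : ℝ) + 1)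
  have ha : StrictAnti a := fun m n hmn => Nat.one_div_lt_one_div hmn
  let w : ℕ → Lp ℝ 2 μ := fun n => indicatorConstLp 2 (measurableSet_Ioo (a := a (n + 1))
    (b := a n)) (measure_ne_top _ _) (1 : ℝ)
  have hinner : ∀ m n, inner ℝ (w m) (w n) =
      μ.real (Ioo (a (m + 1)) (a m) ∩ Ioo (a (n + 1)) (a n)) :=
    fun m n => L2.real_inner_indicatorConstLp_one_indicatorConstLp_one measurableSet_Ioo
      measurableSet_Ioo
  have hlt : ∀ m n, m < n → Ioo (a (m + 1)) (a m) ∩ Ioo (a (n + 1)) (a n) = ∅ := by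
    intro m n hmn
    rw [eq_empty_iff_forall_notMem]
    rintro x ⟨h1, h2⟩
    have := ha.antitone (Nat.succ_le_of_lt hmn)
    exact absurd (h1.1.trans h2.2) (not_lt.2 this)
  have hli : LinearIndependent ℝ w := by
    refine linearIndependent_of_ne_zero_of_inner_eq_zero (fun n hn => ?_) fun m n hmn => ?_
    · have h1 := hinner n n
      rw [hn, inner_zero_left, inter_self, measureReal_def] at h1
      have h2 : 0 ≤ a (n + 1) := by positivity
      have h3 : a n ≤ 1 := by
        simpa [a] using ha.antitone (Nat.zero_le n)
      have h4 := h _ _ h2 (ha (Nat.lt_succ_self n)) h3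
      exact (ENNReal.toReal_pos h4.ne' (measure_ne_top _ _)).ne h1
    · change inner ℝ (w m) (w n) = 0
      rw [hinner]
      rcases hmn.lt_or_gt with h1 | h1
      · rw [hlt m n h1, measureReal_empty]
      · rw [inter_comm, hlt n m h1, measureReal_empty]
  have := hli.finite_of_isNoetherian
  exact _root_.not_finite ℕ

end Green

/-! ### The Laplacian in terms of the Volterra operator -/

section Laplacian

variable {W V : ℝ → ℝ}

/-- The measure `dW` on the fundamental domain `(0, 1]`. -/
def cotorusMeas (hW : Monotone W) : Measure ℝ := (dMeas hW).restrict (Ioc 0 1)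

instance (hW : Monotone W) : IsFiniteMeasure (cotorusMeas hW) :=
  ⟨by
    rw [cotorusMeas, Measure.restrict_apply_univ]
    exact (measure_mono Ioc_subset_Icc_self).trans_lt isCompact_Icc.measure_lt_top⟩

theorem cotorusMeas_restrict_Iic (hW : Monotone W) {x : ℝ} (hx : x ≤ 1) :
    (cotorusMeas hW).restrict (Iic x) = (dMeas hW).restrict (Ioc 0 x) := by
  rw [cotorusMeas, Measure.restrict_restrict measurableSet_Iic]
  congr 1
  ext s
  simp only [mem_inter_iff, mem_Iic, mem_Ioc]
  exact ⟨fun h => ⟨h.2.1, h.1⟩, fun h => ⟨h.2, h.1, h.2.trans hx⟩⟩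

/-- The function in the definition of the Laplacian is, up to the constant `a`, the `dW`-primitive
of `b + ∫_{[0,·)} h dV`. -/
theorem primitive_eq (hW : Monotone W) (hV : Monotone V)
    (hr : ∀ x, ContinuousWithinAt W (Ioi x) x) (h : L2 hV) (b : ℝ) {x : ℝ}
    (hx : x ∈ Icc (0 : ℝ) 1) :
    b * (W x - W 0) + primWV hW hV h x = ∫ y in Iic x,
      (volterra (torusMeas hV) (cotorusMeas hW) h + b • oneLp (cotorusMeas hW) : Lp ℝ 2 _) y
        ∂(cotorusMeas hW) := by
  have h1 : ∀ᵐ y ∂(cotorusMeas hW).restrict (Iic x),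
      (volterra (torusMeas hV) (cotorusMeas hW) h + b • oneLp (cotorusMeas hW) : Lp ℝ 2 _) y =
        (∫ s in Iio y, h s ∂(torusMeas hV)) + b := by
    refine ae_restrict_of_ae ?_
    filter_upwards [Lp.coeFn_add (volterra (torusMeas hV) (cotorusMeas hW) h)
      (b • oneLp (cotorusMeas hW)), coeFn_volterra (torusMeas hV) (cotorusMeas hW) h,
      Lp.coeFn_smul b (oneLp (cotorusMeas hW)), coeFn_oneLp (cotorusMeas hW)] with y h1 h2 h3 h4
    rw [h1, Pi.add_apply, h2, h3, Pi.smul_apply, h4, smul_eq_mul, mul_one]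
  rw [integral_congr_ae h1, cotorusMeas_restrict_Iic hW hx.2, integral_add
    (integrableOn_setIntegral_Iio hW hV h) (integrableOn_const (by
      rw [dMeas_Ioc hW hr]; exact ENNReal.ofReal_ne_top)), primWV_eq _ _ _ hx.2, setIntegral_const,
    measureReal_def, dMeas_Ioc hW hr, ENNReal.toReal_ofReal (sub_nonneg.2 (hW hx.1)), smul_eq_mul]
  ring

/-- The Laplacian through the Volterra operator `A` and its adjoint: `Δ f = h` if and only if `h`
has mean zero and `f` differs by a constant from `-A†` of the mean-zero part of `A h`. -/
theorem isLaplacian_iff (hW : Monotone W) (hV : Monotone V)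
    (hr : ∀ x, ContinuousWithinAt W (Ioi x) x) (f h : L2 hV) :
    IsLaplacian hW hV f h ↔ inner ℝ (oneLp (torusMeas hV)) h = 0 ∧
      ∃ c : ℝ, f = c • oneLp (torusMeas hV) - (volterra (torusMeas hV) (cotorusMeas hW)).adjoint
        (meanProj (cotorusMeas hW) (volterra (torusMeas hV) (cotorusMeas hW) h)) := by
  set μ := torusMeas hV with hμ
  set ν := cotorusMeas hW with hν
  -- integrating against the whole of `ν` is evaluating the primitive at `1`
  have hfull : ∀ g : Lp ℝ 2 ν, ∫ y in Iic 1, g y ∂ν = inner ℝ (oneLp ν) g := by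
    intro g
    have : ν.restrict (Iic 1) = ν := cotorusMeas_restrict_Iic hW le_rfl
    rw [this, inner_oneLp]
  have hright : ∀ (a b : ℝ) (g : Lp ℝ 2 ν), g = volterra μ ν h + b • oneLp ν →
      inner ℝ (oneLp ν) g = 0 →
      ∀ᵐ x ∂μ, (a • oneLp μ - (volterra μ ν).adjoint g : Lp ℝ 2 μ) x =
        a + b * (W x - W 0) + primWV hW hV h x := by
    intro a b g hg hg0
    filter_upwards [Lp.coeFn_sub (a • oneLp μ) ((volterra μ ν).adjoint g),
      Lp.coeFn_smul a (oneLp μ), coeFn_oneLp μ, coeFn_adjoint_volterra μ ν g,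
      ae_torus_mem hV] with x h1 h2 h3 h4 h5
    rw [h1, Pi.sub_apply, h2, Pi.smul_apply, h3, h4, add_assoc,
      primitive_eq hW hV hr h b ⟨h5.1, h5.2.le⟩, ← hg, smul_eq_mul, mul_one]
    have h6 := integral_add_compl (measurableSet_Iic (a := x)) (L2_integrable g)
    rw [compl_Iic, ← inner_oneLp, hg0] at h6
    change _ = a + ∫ y in Iic x, g y ∂ν
    linarith
  rw [inner_oneLp]
  refine and_congr Iff.rfl ⟨?_, ?_⟩
  · rintro ⟨a, b, h2, h3⟩
    set g : Lp ℝ 2 ν := volterra μ ν h + b • oneLp ν with hg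
    have hg0 : inner ℝ (oneLp ν) g = 0 := by
      rw [← hfull, ← h3]
      exact (primitive_eq hW hV hr h b ⟨zero_le_one, le_rfl⟩).symm
    have hPg : meanProj ν (volterra μ ν h) = g := by
      rw [← meanProj_eq_self hg0, hg, map_add, map_smul, meanProj_oneLp, smul_zero, add_zero]
    refine ⟨a, ?_⟩
    rw [hPg]
    refine Lp.ext ?_
    filter_upwards [h2, hright a b g hg hg0] with x hx hx'
    rw [hx, hx']
  · rintro ⟨c, rfl⟩
    obtain ⟨c', hc'⟩ := exists_meanProj_eq ν (volterra μ ν h)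
    have hg0 := inner_oneLp_meanProj ν (volterra μ ν h)
    have hg : meanProj ν (volterra μ ν h) = volterra μ ν h + (-c') • oneLp ν := by
      rw [hc', neg_smul, sub_eq_add_neg]
    refine ⟨c, -c', hright c (-c') _ hg hg0, ?_⟩
    rw [primitive_eq hW hV hr h (-c') ⟨zero_le_one, le_rfl⟩]
    change ∫ y in Iic 1, (volterra μ ν h + (-c') • oneLp ν : Lp ℝ 2 ν) y ∂ν = 0
    rw [← hg, hfull, hg0]

theorem mem_eigenspace_iff_isLaplacian (hW : StrictMono W) (hV : StrictMono V)
    (hr : ∀ x, ContinuousWithinAt W (Ioi x) x) (x : ℝ) (f : L2 hV.monotone) :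
    f ∈ eigenspace hW.monotone hV.monotone x ↔
      IsLaplacian hW.monotone hV.monotone f (-x • f) := by
  rw [eigenspace, laplacian_graph hW hV hr]
  rfl

theorem eigenspace_eq_eigenspace_greenOp (hW : StrictMono W) (hV : StrictMono V)
    (hr : ∀ x, ContinuousWithinAt W (Ioi x) x) {x : ℝ} (hx : x ≠ 0) :
    eigenspace hW.monotone hV.monotone x = Module.End.eigenspace
      (greenOp (torusMeas hV.monotone) (cotorusMeas hW.monotone) : Module.End ℝ _) x⁻¹ := by
  set μ := torusMeas hV.monotone with hμ
  set ν := cotorusMeas hW.monotone with hν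
  ext f
  rw [mem_eigenspace_iff_isLaplacian hW hV hr, isLaplacian_iff _ _ hr,
    Module.End.mem_eigenspace_iff]
  change _ ↔ greenOp μ ν f = x⁻¹ • f
  rw [inner_smul_right, mul_eq_zero, or_iff_right (neg_ne_zero.2 hx), map_smul, map_smul, map_smul]
  constructor
  · rintro ⟨h1, c, h2⟩
    have h3 := congrArg (meanProj μ) h2
    rw [map_sub, map_smul, map_smul, meanProj_oneLp, meanProj_eq_self h1, smul_zero, zero_sub,
      neg_smul, neg_neg] at h3
    rw [greenOp_apply, meanProj_eq_self h1, eq_inv_smul_iff₀ hx]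
    exact h3.symm
  · intro h
    rw [eq_inv_smul_iff₀ hx, greenOp_apply] at h
    have h1 : inner ℝ (oneLp μ) f = 0 := by
      rw [← h, inner_smul_right, inner_oneLp_meanProj, mul_zero]
    rw [meanProj_eq_self h1] at h
    obtain ⟨c, hc⟩ := exists_meanProj_eq μ
      ((volterra μ ν).adjoint (meanProj ν (volterra μ ν f)))
    refine ⟨h1, -(x * c), ?_⟩
    rw [hc, smul_sub, smul_smul] at h
    rw [neg_smul, neg_smul, sub_neg_eq_add, neg_add_eq_sub]
    exact h.symm

theorem eigenspace_zero (hW : StrictMono W) (hV : StrictMono V)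
    (hr : ∀ x, ContinuousWithinAt W (Ioi x) x) :
    eigenspace hW.monotone hV.monotone 0 = Submodule.span ℝ {oneLp (torusMeas hV.monotone)} := by
  ext f
  rw [mem_eigenspace_iff_isLaplacian hW hV hr, isLaplacian_iff _ _ hr,
    Submodule.mem_span_singleton]
  simp [eq_comm]

/-- The Green operator vanishes on constants only, because the Laplacian is single-valued. -/
theorem greenOp_eigenspace_zero_le (hW : StrictMono W) (hV : StrictMono V)
    (hr : ∀ x, ContinuousWithinAt W (Ioi x) x) :
    Module.End.eigenspace
      (greenOp (torusMeas hV.monotone) (cotorusMeas hW.monotone) : Module.End ℝ _) 0 ≤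
      Submodule.span ℝ {oneLp (torusMeas hV.monotone)} := by
  set μ := torusMeas hV.monotone with hμ
  set ν := cotorusMeas hW.monotone with hν
  intro f hf
  rw [Module.End.mem_eigenspace_iff, zero_smul] at hf
  have h0 : greenOp μ ν f = 0 := hf
  obtain ⟨c, hc⟩ := exists_meanProj_eq μ
    ((volterra μ ν).adjoint (meanProj ν (volterra μ ν (meanProj μ f))))
  rw [greenOp_apply, hc] at h0
  have h1 : meanProj μ f = 0 := by
    refine laplacian_unique hW hV hr ((isLaplacian_iff _ _ hr _ _).2
      ⟨inner_oneLp_meanProj μ f, c, ?_⟩)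
    rw [← neg_sub, h0, neg_zero]
  obtain ⟨c', hc'⟩ := exists_meanProj_eq μ f
  rw [h1] at hc'
  exact Submodule.mem_span_singleton.2 ⟨c', (sub_eq_zero.1 hc'.symm).symm⟩

theorem torusMeas_Ioo_pos (hV : StrictMono V) {p q : ℝ} (hp : 0 ≤ p) (hpq : p < q) (hq : q ≤ 1) :
    0 < torusMeas hV.monotone (Ioo p q) := by
  rw [torusMeas, Measure.restrict_apply measurableSet_Ioo, inter_eq_left.2]
  · exact dMeas_Ioo_pos hV hpq
  · exact fun x hx => ⟨hp.trans hx.1.le, hx.2.trans_le hq⟩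

theorem rank_eigenspace_zero (hW : StrictMono W) (hV : StrictMono V)
    (hr : ∀ x, ContinuousWithinAt W (Ioi x) x) :
    Module.rank ℝ (eigenspace hW.monotone hV.monotone 0) = 1 := by
  rw [eigenspace_zero hW hV hr, Module.rank_eq_one_iff_finrank_eq_one, finrank_span_singleton]
  intro h
  have h1 := coeFn_oneLp (torusMeas hV.monotone)
  rw [h] at h1
  have h2 : ∀ᵐ x ∂(torusMeas hV.monotone), False := by
    filter_upwards [h1, Lp.coeFn_zero ℝ 2 (torusMeas hV.monotone)] with x hx hx'
    rw [hx'] at hx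
    simp at hx
  have h3 : torusMeas hV.monotone (Ioo 0 1) = 0 :=
    measure_mono_null (fun _ _ => by simp) (ae_iff.1 h2)
  exact (torusMeas_Ioo_pos hV le_rfl one_pos le_rfl).ne' h3

theorem exists_isEigenvalueSequence (hW : StrictMono W) (hV : StrictMono V)
    (hr : ∀ x, ContinuousWithinAt W (Ioi x) x) :
    ∃ lam : ℕ → ℝ, IsEigenvalueSequence hW.monotone hV.monotone lam :=
  exists_eigenvalue_sequence (greenOp_quadraticDecay _ _) (greenOp_isCompactOperator _ _)
    (greenOp_isSymmetric _ _) (inner_greenOp_self_nonneg _ _)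
    (Submodule.finiteDimensional_of_le (greenOp_eigenspace_zero_le hW hV hr))
    (not_finiteDimensional_L2 _ fun _ _ => torusMeas_Ioo_pos hV)
    (fun _ hx => eigenspace_eq_eigenspace_greenOp hW hV hr hx) (rank_eigenspace_zero hW hV hr)

theorem IsEigenvalueSequence.zero_and_pos (hW : StrictMono W) (hV : StrictMono V)
    (hr : ∀ x, ContinuousWithinAt W (Ioi x) x) {lam : ℕ → ℝ}
    (h : IsEigenvalueSequence hW.monotone hV.monotone lam) :
    lam 0 = 0 ∧ ∀ n, 1 ≤ n → 0 < lam n :=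
  eigenvalue_sequence_pos (inner_greenOp_self_nonneg _ _)
    (fun _ hx => eigenspace_eq_eigenspace_greenOp hW hV hr hx) (rank_eigenspace_zero hW hV hr)
    h.1 h.2

theorem IsEigenvalueSequence.lower_bound (hW : StrictMono W) (hV : StrictMono V)
    (hr : ∀ x, ContinuousWithinAt W (Ioi x) x) {lam : ℕ → ℝ}
    (h : IsEigenvalueSequence hW.monotone hV.monotone lam) :
    ∃ C : ℝ, 0 < C ∧ ∀ n : ℕ, 1 ≤ n → C * (n : ℝ) ^ 2 ≤ lam n :=
  eigenvalue_sequence_lower_bound (greenOp_quadraticDecay _ _) (levelBound_pos _ _)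
    (greenOp_isCompactOperator _ _) (greenOp_isSymmetric _ _) (inner_greenOp_self_nonneg _ _)
    (fun _ hx => eigenspace_eq_eigenspace_greenOp hW hV hr hx) (rank_eigenspace_zero hW hV hr)
    h.1 h.2

end Laplacian

/-! ### The case `W(x) = V(x) = x` -/

section Lebesgue

theorem dMeas_id : dMeas (F := fun x => x) monotone_id = volume := by
  rw [dMeas, Real.volume_eq_stieltjes_id]
  congr 1
  ext x
  rw [Monotone.stieltjesFunction_eq]
  exact (monotone_id.continuousWithinAt_Ioi_iff_rightLim_eq (x := x)).1
    continuous_id.continuousWithinAt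

/-- The function `x ↦ cos (2πkx)` is an eigenfunction with eigenvalue `(2πk)²`. -/
theorem eigenspace_lebesgue_ne_bot {k : ℕ} :
    eigenspace (W := fun x => x) (V := fun x => x) monotone_id monotone_id
      ((2 * Real.pi * k) ^ 2) ≠ ⊥ := by
  set w : ℝ := 2 * Real.pi * k with hw
  let f : ℝ → ℝ := fun x => Real.cos (w * x)
  have hcont : Continuous f := by fun_prop
  have hf : MemLp f 2 (torusMeas (V := fun x => x) monotone_id) :=
    MemLp.of_bound hcont.aestronglyMeasurable 1
      (Eventually.of_forall fun x => Real.abs_cos_le_one _)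
  let u : L2 (V := fun x => x) monotone_id := hf.toLp f
  have hu := hf.coeFn_toLp
  set h : L2 (V := fun x => x) monotone_id := -w ^ 2 • u with hh
  have hhf : h =ᵐ[torusMeas (V := fun x => x) monotone_id] fun x => -w ^ 2 * f x := by
    filter_upwards [Lp.coeFn_smul (-w ^ 2) u, hu] with x h1 h2
    rw [h1, Pi.smul_apply, h2, smul_eq_mul]
  have hsin1 : Real.sin w = 0 := by
    have : w = (k * 2 : ℕ) * Real.pi := by rw [hw]; push_cast; ring
    rw [this, Real.sin_nat_mul_pi]
  have hprimV : ∀ y ∈ Icc (0 : ℝ) 1,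
      ∫ s in Iio y, h s ∂(torusMeas (V := fun x => x) monotone_id) = -w * Real.sin (w * y) := by
    intro y hy
    rw [integral_congr_ae (ae_restrict_of_ae hhf), ← primV_eq _ _ hy.2, primV, dMeas_id,
      integral_Ico_eq_integral_Ioo, ← integral_Ioc_eq_integral_Ioo,
      ← intervalIntegral.integral_of_le hy.1]
    rw [intervalIntegral.integral_eq_sub_of_hasDerivAt (f := fun y => -w * Real.sin (w * y))]
    · simp
    · intro x _
      have h1 := ((hasDerivAt_id x).const_mul w).sin.const_mul (-w)
      refine h1.congr_deriv ?_
      simp only [f, id]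
      ring
    · exact (continuous_const.mul hcont).intervalIntegrable _ _
  have hprimWV : ∀ x ∈ Icc (0 : ℝ) 1,
      primWV (W := fun x => x) (V := fun x => x) monotone_id monotone_id h x = f x - 1 := by
    intro x hx
    rw [primWV_eq _ _ _ hx.2, setIntegral_congr_fun measurableSet_Ioc
      (fun y hy => hprimV y ⟨hy.1.le, hy.2.trans hx.2⟩), dMeas_id,
      ← intervalIntegral.integral_of_le hx.1]
    rw [intervalIntegral.integral_eq_sub_of_hasDerivAt (f := f)]
    · simp [f]
    · intro x _
      have h1 := ((hasDerivAt_id x).const_mul w).cos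
      refine h1.congr_deriv ?_
      simp only [id]
      ring
    · exact Continuous.intervalIntegrable (by fun_prop) _ _
  have hlap : IsLaplacian (W := fun x => x) (V := fun x => x) monotone_id monotone_id u h := by
    refine ⟨?_, 1, 0, ?_, ?_⟩
    · have h1 := hprimV 1 ⟨zero_le_one, le_rfl⟩
      rw [← primV_eq _ _ le_rfl, mul_one, hsin1, mul_zero] at h1
      exact h1
    · filter_upwards [hu, ae_torus_mem (V := fun x => x) monotone_id] with x h1 h2
      rw [h1, hprimWV x ⟨h2.1, h2.2.le⟩]
      ring
    · rw [hprimWV 1 ⟨zero_le_one, le_rfl⟩]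
      have : Real.cos w = 1 := by
        rw [hw, mul_comm]
        exact Real.cos_nat_mul_two_pi k
      simp [f, this]
  have hmem : u ∈ eigenspace (W := fun x => x) (V := fun x => x) monotone_id monotone_id (w ^ 2) :=
    (mem_eigenspace_iff_isLaplacian strictMono_id strictMono_id
      (fun x => continuous_id.continuousWithinAt) (w ^ 2) u).2 hlap
  refine Submodule.ne_bot_iff _ |>.2 ⟨u, hmem, fun hu0 => ?_⟩
  -- the continuous function `f` would vanish almost everywhere near `0`, where it is positive
  have h1 : ∀ᵐ x ∂(volume : Measure ℝ), x ∈ Ico (0 : ℝ) 1 → f x = 0 := by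
    rw [← ae_restrict_iff' measurableSet_Ico]
    have : torusMeas (V := fun x => x) monotone_id = volume.restrict (Ico 0 1) := by
      rw [torusMeas, dMeas_id]
    rw [← this]
    filter_upwards [hu, Lp.coeFn_zero ℝ 2 (torusMeas (V := fun x => x) monotone_id)] with x h2 h3
    change u x = f x at h2
    rw [← h2, hu0, h3, Pi.zero_apply]
  have h2 : ∀ᶠ x in 𝓝[>] (0 : ℝ), f x ≠ 0 := by
    have : f 0 ≠ 0 := by simp [f]
    exact (hcont.continuousAt.eventually_ne this).filter_mono nhdsWithin_le_nhds
  obtain ⟨q, hq, hq'⟩ := (mem_nhdsGT_iff_exists_Ioo_subset' one_pos).1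
    (inter_mem h2 (Ioo_mem_nhdsGT one_pos))
  have h3 : (volume : Measure ℝ) (Ioo 0 q) = 0 := by
    refine measure_mono_null ?_ h1
    intro z hz
    have h5 := hq' hz
    exact fun h6 => h5.1 (h6 ⟨h5.2.1.le, h5.2.2⟩)
  simp only [Real.volume_Ioo, sub_zero, ENNReal.ofReal_eq_zero] at h3
  exact absurd hq (not_lt.2 h3)

/-- As each of the `n + 1` numbers `(2πk)²` with `k ≤ n` is an eigenvalue, the `n`-th eigenvalue
is at most `(2πn)²`. -/
theorem eigenvalue_lebesgue_le {lam : ℕ → ℝ}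
    (h : IsEigenvalueSequence (W := fun x => x) (V := fun x => x) monotone_id monotone_id lam)
    (n : ℕ) : lam n ≤ (2 * Real.pi * n) ^ 2 := by
  have hex : ∀ k : ℕ, ∃ i, lam i = (2 * Real.pi * k) ^ 2 := by
    intro k
    by_contra! hcon
    have h1 := h.2 ((2 * Real.pi * k) ^ 2)
    rw [Cardinal.mk_eq_zero_iff.2 ⟨fun i => hcon i.1 i.2⟩] at h1
    exact eigenspace_lebesgue_ne_bot (Submodule.rank_eq_zero.1 h1)
  choose i hi using hex
  have hinj : Function.Injective i := by
    intro a b hab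
    have h1 := hi a
    rw [hab, hi b] at h1
    have h2 := (pow_left_inj₀ (by positivity) (by positivity) two_ne_zero).1 h1
    exact_mod_cast (mul_left_cancel₀ (by positivity) h2).symm
  obtain ⟨k, hk, hik⟩ : ∃ k ≤ n, n ≤ i k := by
    by_contra! hcon
    have h1 : (Finset.range (n + 1)).card ≤ (Finset.range n).card :=
      Finset.card_le_card_of_injOn i
        (fun k hk => by
          have := hcon k (Nat.lt_succ_iff.1 (Finset.mem_range.1 hk))
          simpa using this) hinj.injOn
    simp at h1
  calc lam n ≤ lam (i k) := h.1 hik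
    _ = (2 * Real.pi * k) ^ 2 := hi k
    _ ≤ (2 * Real.pi * n) ^ 2 := by gcongr

end Lebesgue

/-! ### Consequences of quadratic growth -/

section Growth

theorem summable_one_div_rpow_of_quadratic {lam : ℕ → ℝ} {C : ℝ} (hC : 0 < C)
    (h : ∀ n : ℕ, 1 ≤ n → C * (n : ℝ) ^ 2 ≤ lam n) {s : ℝ} (hs : 1 / 2 < s) :
    Summable fun i : ℕ => 1 / lam (i + 1) ^ s := by
  have h1 : Summable fun n : ℕ => 1 / ((n + 1 : ℕ) : ℝ) ^ (2 * s) :=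
    (summable_nat_add_iff 1).2 (Real.summable_one_div_nat_rpow.2 (by linarith))
  have hlow : ∀ i : ℕ, 0 < C * ((i + 1 : ℕ) : ℝ) ^ 2 := fun i => by positivity
  refine (h1.mul_left (C ^ s)⁻¹).of_nonneg_of_le (fun i => ?_) fun i => ?_
  · have := (hlow i).trans_le (h (i + 1) (Nat.le_add_left 1 i))
    positivity
  · have h2 : (C * ((i + 1 : ℕ) : ℝ) ^ 2) ^ s ≤ lam (i + 1) ^ s :=
      Real.rpow_le_rpow (hlow i).le (h (i + 1) (Nat.le_add_left 1 i)) (by linarith)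
    have h3 : (C * ((i + 1 : ℕ) : ℝ) ^ 2) ^ s = C ^ s * ((i + 1 : ℕ) : ℝ) ^ (2 * s) := by
      rw [Real.mul_rpow hC.le (by positivity), Real.rpow_mul (by positivity), Real.rpow_two]
    rw [← one_div, one_div_mul_one_div, ← h3]
    exact one_div_le_one_div_of_le (Real.rpow_pos_of_pos (hlow i) s) h2

theorem half_le_of_rpow_le_quadratic {C C' ρ : ℝ} (hC' : 0 < C') (hρ : 0 < ρ)
    (h : ∀ n : ℕ, 1 ≤ n → C' * (n : ℝ) ^ (1 / ρ) ≤ C * (n : ℝ) ^ 2) : 1 / 2 ≤ ρ := by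
  by_contra! hlt
  have hpos : 0 < 1 / ρ - 2 := by
    rw [sub_pos, lt_div_iff₀ hρ]
    linarith
  have ht : Tendsto (fun n : ℕ => (n : ℝ) ^ (1 / ρ - 2)) atTop atTop :=
    (tendsto_rpow_atTop hpos).comp tendsto_natCast_atTop_atTop
  obtain ⟨n, hn, hn1⟩ := ((ht.eventually_gt_atTop (C / C')).and (eventually_ge_atTop 1)).exists
  have hn0 : (0 : ℝ) < n := by exact_mod_cast hn1
  have h1 := h n hn1
  rw [Real.rpow_sub hn0, Real.rpow_two, div_lt_div_iff₀ hC' (by positivity)] at hn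
  linarith

end Growth

end WVLaplacian
end

open WVLaplacian in
theorem mainTheorem1 :
    (∀ (W V : ℝ → ℝ) (hW : StrictMono W) (hV : StrictMono V),
      (∀ x, ContinuousWithinAt W (Set.Ioi x) x) →
      (∀ x, ContinuousWithinAt V (Set.Iio x) x) →
      (∀ x, W (x + 1) - W x = W 1 - W 0) →
      (∀ x, V (x + 1) - V x = V 1 - V 0) →
      (∃ lam : ℕ → ℝ, IsEigenvalueSequence hW.monotone hV.monotone lam) ∧
      ∀ lam : ℕ → ℝ, IsEigenvalueSequence hW.monotone hV.monotone lam →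
        lam 0 = 0 ∧
        ∃ ρ : ℝ, 0 < ρ ∧ ρ ≤ 1 / 2 ∧
          (∃ C : ℝ, 0 < C ∧ ∀ n : ℕ, 1 ≤ n → C * (n : ℝ) ^ (1 / ρ) ≤ lam n) ∧
          ∀ s : ℝ, ρ < s → Summable fun i : ℕ => 1 / lam (i + 1) ^ s) ∧
    (∀ lam : ℕ → ℝ,
      IsEigenvalueSequence (W := fun x => x) (V := fun x => x) monotone_id monotone_id lam →
        (∃ c C : ℝ, 0 < c ∧ 0 < C ∧
          ∀ n : ℕ, 1 ≤ n → c * (n : ℝ) ^ 2 ≤ lam n ∧ lam n ≤ C * (n : ℝ) ^ 2) ∧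
        ∀ ρ : ℝ, 0 < ρ →
          (∃ C : ℝ, 0 < C ∧ ∀ n : ℕ, 1 ≤ n → C * (n : ℝ) ^ (1 / ρ) ≤ lam n) → 1 / 2 ≤ ρ) := by
  refine ⟨fun W V hW hV hr _ _ _ => ⟨exists_isEigenvalueSequence hW hV hr, fun lam h => ?_⟩,
    fun lam h => ?_⟩
  · obtain ⟨C, hC, hlow⟩ := h.lower_bound hW hV hr
    refine ⟨(h.zero_and_pos hW hV hr).1, 1 / 2, by norm_num, le_rfl, ⟨C, hC, fun n hn => ?_⟩,
      fun s hs => summable_one_div_rpow_of_quadratic hC hlow hs⟩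
    rw [one_div_one_div, Real.rpow_two]
    exact hlow n hn
  · obtain ⟨c, hc, hlow⟩ := IsEigenvalueSequence.lower_bound strictMono_id strictMono_id
      (fun x => continuous_id.continuousWithinAt) h
    have hup : ∀ n : ℕ, lam n ≤ (2 * Real.pi) ^ 2 * (n : ℝ) ^ 2 := fun n =>
      (eigenvalue_lebesgue_le h n).trans_eq (mul_pow _ _ _)
    exact ⟨⟨c, (2 * Real.pi) ^ 2, hc, by positivity, fun n hn => ⟨hlow n hn, hup n⟩⟩,
      fun ρ hρ ⟨C, hC, hρlow⟩ => half_le_of_rpow_le_quadratic hC hρ fun n hn =>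
        (hρlow n hn).trans (hup n)⟩
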